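/- Let $0<\alpha<\tfrac12$ and let $\mu$ be a probability measure on $\{1,2,\dots\}$ in the class $\Gamma_\alpha$, that is, $\mu\{n,n+1,\dots\}=n^{-\alpha}L(n)$ for all $n\ge1$, where $L:(0,\infty)\to(0,\infty)$ is slowly varying: $L(u(1+r))/L(u)\to1$ as $u\to\infty$, for every $r>0$. Let $(k_z)_{z\in\mathbb Z}$ be independent with law $\mu$, and let $G_\mu$ be the graph on $\mathbb Z$ with an edge from each $z$ to $z-k_z$. For $p\in(0,1)$ let $\lambda_p$ be the law of the random function $X:\mathbb Z\to\{-1,1\}$ obtained by first sampling $G_\mu$, then independently giving each connected component of $G_\mu$ the value $1$ with probability $p$ and $-1$ with probability $1-p$, and letting $X_z$ be the value of the component of $z$. Put $S_n=\sum_{i=1}^nX_i$. Let $q_0=1$ and, for $n\ge1$, let $q_n=\mathbb P(n\in R_\mu)$, where $R_\mu=\{Y_1+\dots+Y_j:j\ge1\}$ and $Y_1,Y_2,\dots$ are independent with law $\mu$. For $i\ge0$ put $(|Q|^2)_i=\sum_{j=0}^\infty q_jq_{i+j}$. Then each series $(|Q|^2)_i$ converges (in particular $(|Q|^2)_0=\sum_{i\ge0}q_i^2<\infty$);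 for every $n\ge0$, $$\operatorname{Var}(S_n)=\frac{4p(1-p)}{(|Q|^2)_0}\sum_{i=1}^n\sum_{j=1}^n(|Q|^2)_{|i-j|};$$ and, as $n\to\infty$, $$\operatorname{Var}(S_n)\sim\frac{4p(1-p)K_\alpha}{(|Q|^2)_0}\,n^{2\alpha+1}L(n)^{-2},\qquad K_\alpha=\Big[2\alpha(2\alpha+1)\,\Gamma(1-\alpha)^2\,\Gamma(2\alpha)\cos(\pi\alpha)\Big]^{-1},$$ where $f(n)\sim g(n)$ means $f(n)/g(n)\to1$. -/

import Mathlib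

open MeasureTheory ProbabilityTheory Filter Topology

noncomputable section

namespace FracWalk

/-- A positive function on `(0,∞)` that is slowly varying at infinity
(only the values of `L` on `(0,∞)` matter). -/
def SlowlyVarying (L : ℝ → ℝ) : Prop :=
  (∀ u, 0 < u → 0 < L u) ∧
    ∀ r : ℝ, 0 < r → Tendsto (fun u : ℝ => L (u * (1 + r)) / L u) atTop (𝓝 1)

/-- `μ` belongs to the class `Γ_α`, with slowly varying function `L`:
`μ {n, n+1, …} = n ^ (-α) * L n` for every `n ≥ 1`. -/
def MemGamma (α : ℝ) (μ : Measure ℕ) (L : ℝ → ℝ) : Prop :=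
  SlowlyVarying L ∧ ∀ n : ℕ, 1 ≤ n → μ.real (Set.Ici n) = (n : ℝ) ^ (-α) * L n

/-- The graph on `ℤ` in which each vertex `z` is joined to its parent `z - k z`
(orientation forgotten; its connected components are those of the directed graph). -/
def ancestralGraph (k : ℤ → ℕ) : SimpleGraph ℤ :=
  SimpleGraph.fromRel fun z w => w = z - (k z : ℤ)

/-- The law of the labelling of `ℤ` obtained by giving the connected components of
`ancestralGraph k` independent values, `1` with probability `p` and `-1` with probability
`1 - p`, and by assigning to each vertex the value of its component. -/
def labelLaw (p : unitInterval) (k : ℤ → ℕ) : Measure (ℤ → ℤ) :=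
  (Measure.infinitePi fun _ : (ancestralGraph k).ConnectedComponent =>
      bernoulliMeasure (1 : ℤ) (-1) p).map
    fun ξ z => ξ ((ancestralGraph k).connectedComponentMk z)

/-- The law of the i.i.d. family `(k_z)`, `z ∈ ℤ`, of samples of `μ`. -/
def jumpLaw (μ : Measure ℕ) [IsProbabilityMeasure μ] : Measure (ℤ → ℕ) :=
  Measure.infinitePi fun _ : ℤ => μ

/-- The Gibbs measure `λ_p`: sample the random graph, then label its components. -/
def gibbs (μ : Measure ℕ) [IsProbabilityMeasure μ] (p : unitInterval) : Measure (ℤ → ℤ) :=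
  (jumpLaw μ).bind (labelLaw p)

/-- The position `S_n = X_1 + ⋯ + X_n` of the walk with increments `X`. -/
def walk (n : ℕ) (X : ℤ → ℤ) : ℤ := ∑ i ∈ Finset.Icc (1 : ℤ) n, X i

/-- The set `R` of values of the partial sums `X_1 + ⋯ + X_j`, `j ≥ 1`
(the steps are indexed from `0` here). -/
def renewalSet (X : ℕ → ℕ) : Set ℕ := {m | ∃ j, 1 ≤ j ∧ ∑ i ∈ Finset.range j, X i = m}

/-- `q_n`, the probability that `n` belongs to the renewal set of an i.i.d. sequence of
samples of `μ`, with the convention `q_0 = 1`. -/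
def q (μ : Measure ℕ) [IsProbabilityMeasure μ] (n : ℕ) : ℝ :=
  if n = 0 then 1 else (Measure.infinitePi fun _ : ℕ => μ).real {X | n ∈ renewalSet X}

/-- `(|Q|²)_i = ∑_j q_j q_{i+j}`. -/
def qCorr (μ : Measure ℕ) [IsProbabilityMeasure μ] (i : ℕ) : ℝ :=
  ∑' j : ℕ, q μ j * q μ (i + j)

/-- The constant `K_α`. -/
def K (α : ℝ) : ℝ :=
  1 / (2 * α * (2 * α + 1)) *
    (Real.Gamma (1 - α) ^ 2 * Real.Gamma (2 * α) * Real.cos (Real.pi * α))⁻¹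

/-! The measurability that makes the mixture `gibbs` meaningful. -/

lemma measurableSet_adj (z w : ℤ) : MeasurableSet {k : ℤ → ℕ | (ancestralGraph k).Adj z w} := by
  have h : {k : ℤ → ℕ | (ancestralGraph k).Adj z w} =
      {k | z ≠ w ∧ (w = z - (k z : ℤ) ∨ z = w - (k w : ℤ))} := by
    ext k; simp [ancestralGraph]
  rw [h]
  have h1 : ∀ a b : ℤ, MeasurableSet {k : ℤ → ℕ | b = a - (k a : ℤ)} := by
    intro a b
    have h2 : MeasurableSet ((fun k : ℤ → ℕ => k a) ⁻¹' {m : ℕ | b = a - (m : ℤ)}) :=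
      measurable_pi_apply a MeasurableSet.of_discrete
    exact h2
  exact (MeasurableSet.const _).inter ((h1 z w).union (h1 w z))

lemma measurableSet_reachable (z w : ℤ) :
    MeasurableSet {k : ℤ → ℕ | (ancestralGraph k).Reachable z w} := by
  have key : ∀ (n : ℕ) (z : ℤ),
      MeasurableSet {k : ℤ → ℕ | ∃ W : (ancestralGraph k).Walk z w, W.length = n} := by
    intro n
    induction n with
    | zero =>
      intro z
      have : {k : ℤ → ℕ | ∃ W : (ancestralGraph k).Walk z w, W.length = 0} = {_k | z = w} := by
        ext k
        exact SimpleGraph.Walk.exists_length_eq_zero_iff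
      rw [this]
      exact MeasurableSet.const _
    | succ n ih =>
      intro z
      have : {k : ℤ → ℕ | ∃ W : (ancestralGraph k).Walk z w, W.length = n + 1} =
          ⋃ u : ℤ, {k | (ancestralGraph k).Adj z u} ∩
            {k | ∃ W : (ancestralGraph k).Walk u w, W.length = n} := by
        ext k
        simp only [Set.mem_ofPred_eq, Set.mem_iUnion, Set.mem_inter_iff]
        constructor
        · rintro ⟨W, hW⟩
          cases W with
          | nil => simp at hW
          | cons h W' => exact ⟨_, h, W', by simpa using hW⟩
        · rintro ⟨u, h, W, hW⟩
          exact ⟨SimpleGraph.Walk.cons h W, by simp [hW]⟩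
      rw [this]
      exact MeasurableSet.iUnion fun u => (measurableSet_adj z u).inter (ih u)
  have : {k : ℤ → ℕ | (ancestralGraph k).Reachable z w} =
      ⋃ n : ℕ, {k | ∃ W : (ancestralGraph k).Walk z w, W.length = n} := by
    ext k
    simp only [Set.mem_ofPred_eq, Set.mem_iUnion]
    exact ⟨fun ⟨W⟩ => ⟨_, W, rfl⟩, fun ⟨_, W, _⟩ => ⟨W⟩⟩
  rw [this]
  exact MeasurableSet.iUnion fun n => key n z

instance isProbabilityMeasure_labelLaw (p : unitInterval) (k : ℤ → ℕ) :
    IsProbabilityMeasure (labelLaw p k) := by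
  unfold labelLaw
  exact Measure.isProbabilityMeasure_map
    (measurable_pi_lambda _ fun z => measurable_pi_apply _).aemeasurable

open Classical in
lemma measurable_labelLaw (p : unitInterval) : Measurable (labelLaw p) := by
  let e : ℕ ≃ ℤ := (Denumerable.eqv ℤ).symm
  have hex : ∀ (z : ℤ) (k : ℤ → ℕ), ∃ n, (ancestralGraph k).Reachable z (e n) :=
    fun z k => ⟨e.symm z, by simp⟩
  let f : ℤ → (ℤ → ℕ) → ℕ := fun z k => Nat.find (hex z k)
  have hf : ∀ z, Measurable (f z) := fun z =>
    measurable_find (hex z) fun n => measurableSet_reachable z (e n)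
  let ν : Measure (ℕ → ℤ) := Measure.infinitePi fun _ : ℕ => bernoulliMeasure (1 : ℤ) (-1) p
  have hjoint : Measurable fun a : (ℤ → ℕ) × (ℕ → ℤ) => fun z : ℤ => a.2 (f z a.1) := by
    refine measurable_pi_lambda _ fun z => ?_
    have h1 : Measurable fun b : ℕ × (ℕ → ℤ) => b.2 b.1 :=
      measurable_from_prod_countable_right fun n => measurable_pi_apply n
    exact h1.comp (((hf z).comp measurable_fst).prodMk measurable_snd)
  have hrep : ∀ k, labelLaw p k = ν.map fun ξ z => ξ (f z k) := by
    intro k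
    let g : (ancestralGraph k).ConnectedComponent → ℕ :=
      fun c => f c.out k
    have hfr : ∀ z, (ancestralGraph k).Reachable z (e (f z k)) := fun z => Nat.find_spec (hex z k)
    have hfe : ∀ z w, (ancestralGraph k).Reachable z w → f z k = f w k := by
      intro z w h
      apply Nat.find_congr'
      intro n
      exact ⟨fun h' => h.symm.trans h', fun h' => h.trans h'⟩
    have hg : Function.Injective g := by
      intro c d hcd
      have h1 := hfr c.out
      have h2 := hfr d.out
      have h3 : f c.out k = f d.out k := hcd
      rw [h3] at h1
      have h4 := SimpleGraph.ConnectedComponent.sound (h1.trans h2.symm)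
      have hc : (ancestralGraph k).connectedComponentMk c.out = c := Quot.out_eq c
      have hd : (ancestralGraph k).connectedComponentMk d.out = d := Quot.out_eq d
      rwa [hc, hd] at h4
    have hgz : ∀ z, g ((ancestralGraph k).connectedComponentMk z) = f z k := by
      intro z
      apply hfe
      exact SimpleGraph.ConnectedComponent.exact (Quot.out_eq _)
    have := Measure.map_infinitePi_infinitePi_of_inj
      (P := fun _ : ℕ => bernoulliMeasure (1 : ℤ) (-1) p) hg
    rw [labelLaw, ← this, Measure.map_map (by fun_prop) (by fun_prop)]
    congr 1
    funext ξ z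
    simp [hgz]
  refine Measure.measurable_of_measurable_coe _ fun A hA => ?_
  have h2 : (fun k => labelLaw p k A) = fun k => ν (Prod.mk k ⁻¹'
      ((fun a : (ℤ → ℕ) × (ℕ → ℤ) => fun z : ℤ => a.2 (f z a.1)) ⁻¹' A)) := by
    funext k
    rw [hrep, Measure.map_apply (by fun_prop) hA]
    rfl
  rw [h2]
  exact measurable_measure_prodMk_left (hjoint hA)

instance isProbabilityMeasure_jumpLaw (μ : Measure ℕ) [IsProbabilityMeasure μ] :
    IsProbabilityMeasure (jumpLaw μ) := by
  unfold jumpLaw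
  infer_instance

instance isProbabilityMeasure_gibbs (μ : Measure ℕ) [IsProbabilityMeasure μ] (p : unitInterval) :
    IsProbabilityMeasure (gibbs μ p) := by
  constructor
  rw [gibbs, Measure.bind_apply MeasurableSet.univ (measurable_labelLaw p).aemeasurable]
  simp

end FracWalk

end

open MeasureTheory ProbabilityTheory Filter Topology

noncomputable section

namespace FracWalk

/-! Write c_i for (|Q|²)_i. Labels of two vertices coincide if their ancestral lines meet and are
independent otherwise, so Cov(X_i, X_j) = 4p(1-p) P(i ~ j) (`covariance_coord`). The exact variance
formula is therefore the identity P(i ~ j) = c_{|i-j|} / c_0 (`connProb_eq`). Moving the larger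
vertex to its parent gives a recursion for P(i ~ j) off the diagonal (`hasSum_connProb`), and the
renewal equation gives the same recursion for c_{|i-j|} / c_0 (`hasSum_qCorr`); both equal 1 on the
diagonal. Induction on the number of steps before meeting gives one inequality (`meet_le`). The
difference is nonnegative and tends to 0 far from the diagonal, while jumps of μ are unbounded, so a
maximum principle makes it vanish.

For the asymptotics, the double sum of c_{|i-j|} is the sum over t of the squares of the window sums
q_t + ... + q_{t-n+1}. The generating function of q is 1/ψ with ψ(s) = E[1 - exp(-sY)], so Parseval
turns that sum into (2π)⁻¹ ∫ |D_n|² / |ψ|² over [-π, π], where D_n is the Dirichlet kernel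
(`RegTail.hasSum_block_sq`). Near the origin |ψ(-iθ)| is bounded below by a multiple of |θ|^β for
any β > α; as α < 1/2, β can be taken below 1/2 and 1/|ψ|² is locally integrable, which also yields
the convergence of the series of q_i².

After the substitution θ = t/n, |D_n|/n tends to |2 sin(t/2)/t| and |ψ|/tail(n) tends to
Γ(1-α)|t|^α; Potter bounds give a dominating function, and the limiting integral is 2πK_α
(`RegTail.tendsto_integral_spec`). Frequencies away from 0, including further zeros of ψ when μ is
carried by a lattice, contribute a bounded amount, negligible against n / tail(n)². -/

/-! ### Regular variation of the tail and Potter bounds -/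

/-- The tail `y ↦ μ [y, ∞)` of a measure on `ℕ`, as a function of a real variable. -/
def tail (μ : Measure ℕ) (y : ℝ) : ℝ := μ.real {k : ℕ | y ≤ (k : ℝ)}

/-- The tail of `μ` is positive and regularly varying with index `-α` along the integers. -/
structure RegTail (α : ℝ) (μ : Measure ℕ) : Prop where
  pos : ∀ y, 0 < tail μ y
  tendsto : ∀ k : ℕ, 1 ≤ k →
    Tendsto (fun n : ℕ => tail μ (k * n : ℕ) / tail μ n) atTop (𝓝 ((k : ℝ) ^ (-α)))

section tail

variable (μ : Measure ℕ)

lemma tail_natCast (n : ℕ) : tail μ n = μ.real (Set.Ici n) := by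
  simp [tail, Set.Ici]

lemma tail_antitone [IsProbabilityMeasure μ] : Antitone (tail μ) := by
  intro x y h
  exact measureReal_mono fun k hk => h.trans hk

lemma tail_le_one [IsProbabilityMeasure μ] (y : ℝ) : tail μ y ≤ 1 := measureReal_le_one

lemma tail_nonneg (y : ℝ) : 0 ≤ tail μ y := measureReal_nonneg

lemma tail_ceil (y : ℝ) : tail μ (⌈y⌉₊ : ℕ) = tail μ y := by
  unfold tail
  congr 1
  ext k
  simp

end tail

lemma MemGamma.tail_eq {α : ℝ} {μ : Measure ℕ} [IsProbabilityMeasure μ] {L : ℝ → ℝ}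
    (h : MemGamma α μ L) {n : ℕ} (hn : 1 ≤ n) : tail μ n = (n : ℝ) ^ (-α) * L n := by
  rw [tail_natCast, h.2 n hn]

lemma MemGamma.regTail {α : ℝ} {μ : Measure ℕ} [IsProbabilityMeasure μ] {L : ℝ → ℝ}
    (h : MemGamma α μ L) : RegTail α μ := by
  have hp : ∀ n : ℕ, 1 ≤ n → 0 < tail μ n := by
    intro n hn
    have : (0 : ℝ) < n := by exact_mod_cast hn
    rw [h.tail_eq hn]
    exact mul_pos (Real.rpow_pos_of_pos this _) (h.1.1 _ this)
  refine ⟨fun y => ?_, fun k hk => ?_⟩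
  · have h1 : y ≤ ((⌈y⌉₊ + 1 : ℕ) : ℝ) := by
      push_cast
      linarith [Nat.le_ceil y]
    exact (hp (⌈y⌉₊ + 1) (by omega)).trans_le (tail_antitone μ h1)
  · have hk0 : (0 : ℝ) < k := by exact_mod_cast hk
    have hlim : Tendsto (fun n : ℕ => L (k * n : ℕ) / L n) atTop (𝓝 1) := by
      -- Slow variation is assumed only for `r > 0`, that is for factors `1 + r > 1`; the factor 1
      -- is trivial.
      rcases Nat.lt_or_ge 1 k with h1 | h1
      · have h2 := h.1.2 ((k : ℝ) - 1) (by
          have : (1 : ℝ) < k := by exact_mod_cast h1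
          linarith)
        refine (h2.comp tendsto_natCast_atTop_atTop).congr fun n => ?_
        simp only [Function.comp]
        congr 2
        push_cast
        ring
      · obtain rfl : k = 1 := by omega
        refine tendsto_const_nhds.congr' ?_
        filter_upwards [eventually_ge_atTop 1] with n hn
        have : L n ≠ 0 := (h.1.1 n (by exact_mod_cast hn)).ne'
        simp [this]
    have h3 := hlim.const_mul ((k : ℝ) ^ (-α))
    rw [mul_one] at h3
    refine h3.congr' ?_
    filter_upwards [eventually_ge_atTop 1] with n hn
    have hn0 : (0 : ℝ) < n := by exact_mod_cast hn
    rw [h.tail_eq hn, h.tail_eq (Nat.mul_pos hk hn)]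
    have : (n : ℝ) ^ (-α) ≠ 0 := (Real.rpow_pos_of_pos hn0 _).ne'
    push_cast
    rw [Real.mul_rpow hk0.le hn0.le]
    field_simp

namespace RegTail

variable {α : ℝ} {μ : Measure ℕ}

/-- Meant for `m n` close to `a n / b`: then `a * n` and `b * m n` nearly coincide, the two
corresponding tails nearly cancel, and the product approximates `tail (m n) / tail n`. This passes
from integer to rational ratios. -/
lemma tendsto_ratio (h : RegTail α μ) {a b : ℕ} (ha : 1 ≤ a) (hb : 1 ≤ b) {m : ℕ → ℕ}
    (hm : Tendsto m atTop atTop) :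
    Tendsto (fun n : ℕ => tail μ (a * n : ℕ) / tail μ n * (tail μ (m n) / tail μ (b * m n : ℕ)))
      atTop (𝓝 (((a : ℝ) / b) ^ (-α))) := by
  have hb0 : (0 : ℝ) < b := by exact_mod_cast hb
  have h1 := (h.tendsto b hb).comp hm
  have h2 := (h.tendsto a ha).mul (h1.inv₀ (Real.rpow_pos_of_pos hb0 _).ne')
  rw [← div_eq_mul_inv, ← Real.div_rpow (by positivity) hb0.le] at h2
  refine h2.congr fun n => ?_
  simp [Function.comp]

variable [IsProbabilityMeasure μ]

/-- The limit of `tail (n x) / tail n` for every real `x > 0`. -/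
lemma tendsto_real (h : RegTail α μ) {x : ℝ} (hx : 0 < x) :
    Tendsto (fun n : ℕ => tail μ (n * x) / tail μ n) atTop (𝓝 (x ^ (-α))) := by
  have hcont : ContinuousAt (fun y : ℝ => y ^ (-α)) x :=
    Real.continuousAt_rpow_const _ _ (Or.inl hx.ne')
  have hm : ∀ a b : ℕ, 1 ≤ a → 1 ≤ b →
      Tendsto (fun n : ℕ => ⌈(n : ℝ) * ((a : ℝ) / b)⌉₊) atTop atTop := by
    intro a b ha hb
    refine tendsto_nat_ceil_atTop.comp ?_
    have : (0 : ℝ) < (a : ℝ) / b := by positivity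
    exact tendsto_natCast_atTop_atTop.atTop_mul_const this
  refine tendsto_order.2 ⟨fun c hc => ?_, fun c hc => ?_⟩
  · -- lower bound through `(a + 1) / b`, where `a = ⌈x b⌉`
    have hseq : Tendsto (fun b : ℕ => ((⌈x * b⌉₊ + 1 : ℕ) : ℝ) / b) atTop (𝓝 x) := by
      have h1 : Tendsto (fun b : ℕ => (⌈x * (b : ℝ)⌉₊ : ℝ) / b) atTop (𝓝 x) :=
        (tendsto_nat_ceil_mul_div_atTop hx.le).comp tendsto_natCast_atTop_atTop
      have h2 := h1.add tendsto_one_div_atTop_nhds_zero_nat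
      rw [add_zero] at h2
      refine h2.congr fun b => ?_
      push_cast
      ring
    have h3 := (hcont.tendsto.comp hseq).eventually (lt_mem_nhds hc)
    obtain ⟨b, hb, hb1⟩ := (h3.and (eventually_ge_atTop 1)).exists
    have hb0 : (0 : ℝ) < b := by exact_mod_cast hb1
    set a := ⌈x * b⌉₊ with ha
    have ha1 : 1 ≤ a := Nat.one_le_iff_ne_zero.2 (Nat.ceil_pos.2 (by positivity)).ne'
    have hxa : x ≤ (a : ℝ) / b := by
      rw [le_div_iff₀ hb0]
      exact Nat.le_ceil _
    have h4 := h.tendsto_ratio (a := a + 1) (by omega) hb1 (hm a b ha1 hb1)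
    filter_upwards [h4.eventually (lt_mem_nhds hb), eventually_ge_atTop b] with n hn hnb
    refine hn.trans_le ?_
    set m := ⌈(n : ℝ) * ((a : ℝ) / b)⌉₊
    have e1 : tail μ m ≤ tail μ (n * x) := by
      rw [tail_ceil]
      exact tail_antitone μ (by gcongr)
    -- `m` is rounded up, so `b * m` exceeds `a * n` by less than `b`; replacing `a` by `a + 1`
    -- absorbs this once `n ≥ b`.
    have e2 : tail μ ((a + 1) * n : ℕ) ≤ tail μ (b * m : ℕ) := by
      apply tail_antitone
      have : (m : ℝ) < n * ((a : ℝ) / b) + 1 := Nat.ceil_lt_add_one (by positivity)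
      have h6 : (b : ℝ) * m ≤ b * (n * ((a : ℝ) / b) + 1) := by gcongr
      have h7 : (b : ℝ) * (n * ((a : ℝ) / b) + 1) = a * n + b := by field_simp
      have h8 : (b : ℝ) ≤ n := by exact_mod_cast hnb
      push_cast
      nlinarith
    have p1 := h.pos n
    have p2 := h.pos (b * m : ℕ)
    rw [div_mul_div_comm, div_le_div_iff₀ (by positivity) p1]
    have := mul_le_mul e2 e1 (h.pos _).le (h.pos _).le
    nlinarith
  -- For the upper bound the rounding of `m` goes in the favourable direction, so `a = ⌊x b⌋` needs
  -- no shift; `b ≥ 1 / x` only ensures `a ≥ 1`.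
  · have hseq : Tendsto (fun b : ℕ => (⌊x * b⌋₊ : ℝ) / b) atTop (𝓝 x) :=
      (tendsto_nat_floor_mul_div_atTop hx.le).comp tendsto_natCast_atTop_atTop
    have h3 := (hcont.tendsto.comp hseq).eventually (gt_mem_nhds hc)
    obtain ⟨B, hB⟩ := exists_nat_ge (1 / x)
    obtain ⟨b, ⟨hb, hb1⟩, hbB⟩ := ((h3.and (eventually_ge_atTop 1)).and (eventually_ge_atTop B)).exists
    have hb0 : (0 : ℝ) < b := by exact_mod_cast hb1
    set a := ⌊x * b⌋₊ with ha
    have ha1 : 1 ≤ a := by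
      apply Nat.le_floor
      have : (1 / x : ℝ) ≤ b := hB.trans (by exact_mod_cast hbB)
      rw [div_le_iff₀ hx] at this
      push_cast
      linarith
    have hxa : (a : ℝ) / b ≤ x := by
      rw [div_le_iff₀ hb0]
      exact Nat.floor_le (by positivity)
    have h4 := h.tendsto_ratio ha1 hb1 (hm a b ha1 hb1)
    filter_upwards [h4.eventually (gt_mem_nhds hb)] with n hn
    refine lt_of_le_of_lt ?_ hn
    set m := ⌈(n : ℝ) * ((a : ℝ) / b)⌉₊
    have e1 : tail μ (n * x) ≤ tail μ m := by
      rw [tail_ceil]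
      exact tail_antitone μ (by gcongr)
    have e2 : tail μ (b * m : ℕ) ≤ tail μ (a * n : ℕ) := by
      apply tail_antitone
      have : (n * ((a : ℝ) / b)) ≤ m := Nat.le_ceil _
      have h6 : (b : ℝ) * (n * ((a : ℝ) / b)) ≤ b * m := by gcongr
      have h7 : (b : ℝ) * (n * ((a : ℝ) / b)) = a * n := by field_simp
      push_cast
      linarith
    have p1 := h.pos n
    have p2 := h.pos (b * m : ℕ)
    rw [div_mul_div_comm, div_le_div_iff₀ p1 (by positivity)]
    have := mul_le_mul e1 e2 (h.pos _).le (h.pos _).le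
    nlinarith

/-- A Potter type lower bound for the tail. -/
lemma potter (h : RegTail α μ) {β : ℝ} (hβ : α < β) (hβ0 : 0 < β) :
    ∃ c : ℝ, 0 < c ∧ ∀ y x : ℝ, 0 ≤ y → 1 ≤ x → c * x ^ (-β) * tail μ y ≤ tail μ (x * y) := by
  -- Beyond some `N`, one doubling multiplies the tail by at least `2 ^ (-β)`, since the limiting
  -- factor `2 ^ (-α)` is larger; dyadic iteration then covers all `x ≥ 1`.
  have h1 : (2 : ℝ) ^ (-β) < ((2 : ℕ) : ℝ) ^ (-α) := by
    push_cast
    exact Real.rpow_lt_rpow_of_exponent_lt one_lt_two (by linarith)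
  obtain ⟨N, hN⟩ := eventually_atTop.1 ((h.tendsto 2 (by norm_num)).eventually (lt_mem_nhds h1))
  have hdouble : ∀ y : ℝ, (N : ℝ) ≤ y → 2 ^ (-β) * tail μ y ≤ tail μ (2 * y) := by
    intro y hy
    have hm : N ≤ ⌈y⌉₊ := by exact_mod_cast hy.trans (Nat.le_ceil y)
    have h2 := hN _ hm
    rw [lt_div_iff₀ (h.pos _), tail_ceil] at h2
    refine h2.le.trans (tail_antitone μ ?_)
    push_cast
    linarith [Nat.le_ceil y]
  have hiter : ∀ (j : ℕ) (y : ℝ), (N : ℝ) ≤ y → ((2 : ℝ) ^ (-β)) ^ j * tail μ y ≤ tail μ (2 ^ j * y) := by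
    intro j
    induction j with
    | zero => intro y _; simp
    | succ j ih =>
      intro y hy
      have hy0 : 0 ≤ y := (Nat.cast_nonneg N).trans hy
      have h2 : (N : ℝ) ≤ 2 ^ j * y := by
        have : (1 : ℝ) ≤ 2 ^ j := one_le_pow₀ (by norm_num)
        nlinarith
      calc ((2 : ℝ) ^ (-β)) ^ (j + 1) * tail μ y
          = 2 ^ (-β) * (((2 : ℝ) ^ (-β)) ^ j * tail μ y) := by ring
        _ ≤ 2 ^ (-β) * tail μ (2 ^ j * y) := by gcongr; exact ih y hy
        _ ≤ tail μ (2 * (2 ^ j * y)) := hdouble _ h2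
        _ = tail μ (2 ^ (j + 1) * y) := by congr 1; ring
  have hlarge : ∀ y x : ℝ, (N : ℝ) ≤ y → 1 ≤ x →
      2 ^ (-β) * x ^ (-β) * tail μ y ≤ tail μ (x * y) := by
    intro y x hy hx
    have hy0 : 0 ≤ y := (Nat.cast_nonneg N).trans hy
    obtain ⟨j, hj1, hj2⟩ := exists_nat_pow_near hx one_lt_two
    calc 2 ^ (-β) * x ^ (-β) * tail μ y
        ≤ 2 ^ (-β) * ((2 : ℝ) ^ j) ^ (-β) * tail μ y := by
          have := h.pos y
          have : x ^ (-β) ≤ ((2 : ℝ) ^ j) ^ (-β) :=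
            Real.rpow_le_rpow_of_nonpos (by positivity) hj1 (by linarith)
          gcongr
      _ = ((2 : ℝ) ^ (-β)) ^ (j + 1) * tail μ y := by
          rw [← Real.rpow_natCast, ← Real.rpow_mul (by norm_num), mul_comm (j : ℝ),
            Real.rpow_mul (by norm_num), Real.rpow_natCast]
          ring
      _ ≤ tail μ (2 ^ (j + 1) * y) := hiter _ _ hy
      _ ≤ tail μ (x * y) := tail_antitone μ (by gcongr)
  have hN0 := h.pos N
  -- The factor `tail μ N` pays for `y ≤ N`, where `tail μ y ≤ 1` and `tail μ (x * y) ≥ tail μ (x *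
  -- N)`.
  refine ⟨2 ^ (-β) * tail μ N, by positivity, fun y x hy hx => ?_⟩
  rcases le_total (N : ℝ) y with hy1 | hy1
  · refine le_trans ?_ (hlarge y x hy1 hx)
    have := h.pos y
    have h3 := tail_le_one μ N
    calc 2 ^ (-β) * tail μ N * x ^ (-β) * tail μ y ≤ 2 ^ (-β) * 1 * x ^ (-β) * tail μ y := by gcongr
      _ = _ := by ring
  · have h3 := tail_le_one μ y
    calc 2 ^ (-β) * tail μ N * x ^ (-β) * tail μ y ≤ 2 ^ (-β) * tail μ N * x ^ (-β) * 1 := by gcongr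
      _ = 2 ^ (-β) * x ^ (-β) * tail μ N := by ring
      _ ≤ tail μ (x * N) := hlarge N x le_rfl hx
      _ ≤ tail μ (x * y) := tail_antitone μ (by gcongr)

end RegTail

/-! ### The Laplace exponent and its behaviour at scale 1/n -/

/-- `lap μ s = E[1 - exp (-s Y)]` for `Y` of law `μ`. -/
def lap (μ : Measure ℕ) (s : ℂ) : ℂ := ∫ k : ℕ, (1 - Complex.exp (-s * k)) ∂μ

lemma norm_exp_neg_mul_le {s : ℂ} (hs : 0 ≤ s.re) {x : ℝ} (hx : 0 ≤ x) :
    ‖Complex.exp (-s * x)‖ ≤ 1 := by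
  rw [Complex.norm_exp]
  simp
  positivity

/-- The Laplace transform of a power, at complex arguments. -/
lemma integral_rpow_mul_cexp {a : ℝ} (ha : 0 < a) {s : ℂ} (hs : 0 < s.re) :
    ∫ x in Set.Ioi (0 : ℝ), ((x ^ (a - 1) : ℝ) : ℂ) * Complex.exp (-s * x) =
      s ^ (-(a : ℂ)) * Real.Gamma a := by
  -- The integral is the complex moment generating function of this infinite measure, analytic on
  -- the left half-plane. Both sides agree for negative reals, so the identity theorem applies.
  let ν : Measure ℝ := (volume.restrict (Set.Ioi 0)).withDensity fun x => ENNReal.ofReal (x ^ (a - 1))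
  have hmeas : Measurable fun x : ℝ => ENNReal.ofReal (x ^ (a - 1)) := by fun_prop
  have hfin : ∀ᵐ x ∂(volume.restrict (Set.Ioi (0 : ℝ))), ENNReal.ofReal (x ^ (a - 1)) < ⊤ :=
    ae_of_all _ fun x => ENNReal.ofReal_lt_top
  have hpos : ∀ x ∈ Set.Ioi (0 : ℝ), (ENNReal.ofReal (x ^ (a - 1))).toReal = x ^ (a - 1) :=
    fun x hx => ENNReal.toReal_ofReal (Real.rpow_nonneg (le_of_lt hx) _)
  have hmgf : ∀ z : ℂ, complexMGF id ν z =
      ∫ x in Set.Ioi (0 : ℝ), ((x ^ (a - 1) : ℝ) : ℂ) * Complex.exp (z * x) := by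
    intro z
    rw [complexMGF, integral_withDensity_eq_integral_toReal_smul hmeas hfin]
    refine setIntegral_congr_fun measurableSet_Ioi fun x hx => ?_
    simp only [hpos x hx, id, Complex.real_smul]
  have hset : Set.Iio (0 : ℝ) ⊆ interior (integrableExpSet id ν) := by
    refine interior_maximal (fun b hb => ?_) isOpen_Iio
    have hb' : 0 < -b := neg_pos.2 hb
    have h1 := integrableOn_rpow_mul_exp_neg_mul_rpow (s := a - 1) (p := 1) (b := -b)
      (by linarith) one_pos hb'
    rw [integrableExpSet, Set.mem_ofPred_eq,
      integrable_withDensity_iff_integrable_smul' hmeas hfin]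
    refine (integrableOn_congr_fun (fun x hx => ?_) measurableSet_Ioi).1 h1
    simp [hpos x hx]
  let U : Set ℂ := {z | z.re < 0}
  have hUo : IsOpen U := isOpen_lt Complex.continuous_re continuous_const
  have hf : AnalyticOnNhd ℂ (complexMGF id ν) U :=
    analyticOnNhd_complexMGF.mono fun z hz => hset hz
  have hg : AnalyticOnNhd ℂ (fun z : ℂ => (-z) ^ (-(a : ℂ)) * Real.Gamma a) U := by
    refine DifferentiableOn.analyticOnNhd (fun z hz => ?_) hUo
    have hz0 : z.re < 0 := hz
    have hz' : -z ∈ Complex.slitPlane := Or.inl (by simpa using hz0)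
    exact ((differentiableAt_id.neg.cpow_const hz').mul_const _).differentiableWithinAt
  have hreal : ∀ b : ℝ, b < 0 →
      complexMGF id ν b = (-(b : ℂ)) ^ (-(a : ℂ)) * Real.Gamma a := by
    intro b hb
    have h1 := Real.integral_rpow_mul_exp_neg_mul_Ioi ha (neg_pos.2 hb)
    have hb0 : 0 ≤ -b := by linarith
    have h2 : ((-(b : ℂ)) ^ (-(a : ℂ)) * Real.Gamma a : ℂ) =
        (((1 / -b) ^ a * Real.Gamma a : ℝ) : ℂ) := by
      rw [one_div, Real.inv_rpow hb0, ← Real.rpow_neg hb0]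
      push_cast
      rw [Complex.ofReal_cpow hb0]
      push_cast
      rfl
    rw [hmgf, h2, ← h1, ← integral_complex_ofReal]
    congr 1
    funext x
    push_cast
    congr 2
    ring
  have hev : ∃ᶠ z in 𝓝[≠] ((-1 : ℝ) : ℂ),
      complexMGF id ν z = (-z) ^ (-(a : ℂ)) * Real.Gamma a := by
    have ht : Tendsto (fun b : ℝ => (b : ℂ)) (𝓝[≠] (-1)) (𝓝[≠] ((-1 : ℝ) : ℂ)) := by
      refine tendsto_nhdsWithin_of_tendsto_nhds_of_eventually_within _
        (Complex.continuous_ofReal.continuousAt.tendsto.mono_left nhdsWithin_le_nhds) ?_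
      filter_upwards [self_mem_nhdsWithin] with b hb
      exact fun h => hb (Complex.ofReal_injective h)
    refine ht.frequently (Eventually.frequently ?_)
    filter_upwards [nhdsWithin_le_nhds (Iio_mem_nhds (show (-1 : ℝ) < 0 by norm_num))] with b hb
    exact hreal b hb
  have hU : IsPreconnected U := (convex_halfSpace_re_lt 0).isPreconnected
  have h3 := hf.eqOn_of_preconnected_of_frequently_eq hg hU (z₀ := ((-1 : ℝ) : ℂ)) (by simp [U]) hev
    (show -s ∈ U by simpa [U] using hs)
  rw [hmgf] at h3
  simpa using h3

section lap

variable {μ : Measure ℕ} [IsProbabilityMeasure μ]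

lemma integrable_exp_neg {s : ℂ} (hs : 0 ≤ s.re) :
    Integrable (fun k : ℕ => Complex.exp (-s * k)) μ :=
  Integrable.of_bound (C := 1) (by fun_prop)
    (ae_of_all _ fun k => by simpa using norm_exp_neg_mul_le hs (x := k) (by positivity))

lemma integrable_one_sub_exp_neg {s : ℂ} (hs : 0 ≤ s.re) :
    Integrable (fun k : ℕ => 1 - Complex.exp (-s * k)) μ :=
  (integrable_const _).sub (integrable_exp_neg hs)

lemma lap_re {s : ℂ} (hs : 0 ≤ s.re) :
    (lap μ s).re = ∫ k : ℕ, (1 - Real.exp (-s.re * k) * Real.cos (s.im * k)) ∂μ := by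
  unfold lap
  rw [← RCLike.re_eq_complex_re, ← integral_re (integrable_one_sub_exp_neg hs)]
  congr 1
  funext k
  simp [Complex.exp_re]

lemma integrable_lap_re {s : ℂ} (hs : 0 ≤ s.re) :
    Integrable (fun k : ℕ => 1 - Real.exp (-s.re * k) * Real.cos (s.im * k)) μ := by
  refine (integrable_one_sub_exp_neg hs).re.congr (ae_of_all _ fun k => ?_)
  simp [Complex.exp_re]

/-- Fubini applied to `1 - exp (-s k) = ∫₀ᵏ s exp (-s x) dx`. -/
lemma lap_eq_integral_tail {s : ℂ} (hs : 0 < s.re) :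
    lap μ s = ∫ x in Set.Ioi (0 : ℝ), (tail μ x : ℂ) * (s * Complex.exp (-s * x)) := by
  have hs0 : s ≠ 0 := by
    rintro rfl
    simp at hs
  let g : ℝ → ℂ := fun x => s * Complex.exp (-s * x)
  have hg : Integrable g (volume.restrict (Set.Ioi 0)) := by
    have := integrableOn_exp_mul_complex_Ioi (a := -s) (by simpa using hs) 0
    exact this.const_mul s
  let f : ℕ → ℝ → ℂ := fun k x => (Set.Iic (k : ℝ)).indicator g x
  have hmeas : MeasurableSet {p : ℕ × ℝ | p.2 ≤ (p.1 : ℝ)} :=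
    measurableSet_le measurable_snd (measurable_from_nat.comp measurable_fst)
  have hf : Integrable (Function.uncurry f) (μ.prod (volume.restrict (Set.Ioi 0))) := by
    have h1 := (Integrable.comp_snd hg μ).indicator hmeas
    refine h1.congr (ae_of_all _ fun p => ?_)
    simp [f, Function.uncurry, Set.indicator_apply]
  have h1 : ∀ k : ℕ, ∫ x in Set.Ioi (0 : ℝ), f k x = 1 - Complex.exp (-s * k) := by
    intro k
    rw [integral_indicator measurableSet_Iic, Measure.restrict_restrict measurableSet_Iic,
      Set.inter_comm, Set.Ioi_inter_Iic, ← intervalIntegral.integral_of_le (by positivity)]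
    simp only [g]
    rw [intervalIntegral.integral_const_mul, integral_exp_mul_complex (neg_ne_zero.2 hs0)]
    simp
    field_simp
    ring
  have h2 : ∀ x : ℝ, ∫ k, f k x ∂μ = (tail μ x : ℂ) * g x := by
    intro x
    have : (fun k : ℕ => f k x) = Set.indicator {k : ℕ | x ≤ k} (fun _ => g x) := by
      funext k
      simp [f, Set.indicator_apply]
    rw [this, integral_indicator_const _ MeasurableSet.of_discrete]
    simp [tail]
  calc lap μ s = ∫ k, (∫ x in Set.Ioi (0 : ℝ), f k x) ∂μ := by simp_rw [h1]; rfl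
    _ = ∫ x in Set.Ioi (0 : ℝ), ∫ k, f k x ∂μ := integral_integral_swap hf
    _ = _ := by simp_rw [h2]; rfl

lemma lap_div_eq {s : ℂ} (hs : 0 < s.re) {n : ℕ} (hn : 1 ≤ n) :
    lap μ (s / n) = ∫ x in Set.Ioi (0 : ℝ), (tail μ (n * x) : ℂ) * (s * Complex.exp (-s * x)) := by
  have hn0 : (0 : ℝ) < n := by exact_mod_cast hn
  have hnC : (n : ℂ) ≠ 0 := by exact_mod_cast hn0.ne'
  have h0 : s / (n : ℂ) = ((n : ℝ)⁻¹ : ℝ) * s := by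
    push_cast
    field_simp
  have h1 : 0 < (s / (n : ℂ)).re := by
    rw [h0, Complex.re_ofReal_mul]
    positivity
  rw [lap_eq_integral_tail h1]
  have h2 := integral_comp_mul_left_Ioi
    (fun x : ℝ => (tail μ x : ℂ) * (s * Complex.exp (-(s / n) * x))) 0 hn0
  rw [mul_zero] at h2
  have h3 : ∫ x in Set.Ioi (0 : ℝ), (tail μ x : ℂ) * (s / n * Complex.exp (-(s / n) * x)) =
      (n : ℝ)⁻¹ • ∫ x in Set.Ioi (0 : ℝ), (tail μ x : ℂ) * (s * Complex.exp (-(s / n) * x)) := by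
    rw [← integral_smul]
    congr 1
    funext x
    simp
    field_simp
  rw [h3, ← h2]
  congr 1
  funext x
  have : -(s / n) * ((n * x : ℝ) : ℂ) = -s * x := by
    push_cast
    field_simp
  rw [this]

/-- `1 - r cos` is affine in `r = exp (-ε k)`, and at both ends `r = 0, 1` it is at least `(1 - cos)
/ 2`. This bounds `1 / ‖lap‖` uniformly in the damping `ε`. -/
lemma half_re_lap_le {ε : ℝ} (hε : 0 ≤ ε) (θ : ℝ) :
    (lap μ (-(θ * Complex.I))).re / 2 ≤ (lap μ (ε - θ * Complex.I)).re := by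
  rw [lap_re (by simp), lap_re (by simpa using hε), ← integral_div]
  refine integral_mono ((integrable_lap_re (by simp)).div_const 2)
    (integrable_lap_re (by simpa using hε)) fun k => ?_
  simp
  have h1 : Real.exp (-(ε * k)) ≤ 1 := Real.exp_le_one_iff.2 (by
    have : 0 ≤ ε * k := by positivity
    linarith)
  have h2 := Real.exp_pos (-(ε * k))
  have h3 := Real.cos_le_one (θ * k)
  have h4 := Real.neg_one_le_cos (θ * k)
  nlinarith

lemma re_lap_nonneg (θ : ℝ) : 0 ≤ (lap μ (-(θ * Complex.I))).re := by
  rw [lap_re (by simp)]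
  refine integral_nonneg fun k => ?_
  simpa using Real.cos_le_one (θ * k)

/-- The difference is the expectation of `exp (iθY) (1 - exp (-εY))`, whose modulus no longer
depends on `θ`. It transfers asymptotics from the open half-plane to the imaginary axis. -/
lemma norm_lap_sub_le {ε : ℝ} (hε : 0 ≤ ε) (θ : ℝ) :
    ‖lap μ (ε - θ * Complex.I) - lap μ (-(θ * Complex.I))‖ ≤ ‖lap μ ε‖ := by
  have h1 : 0 ≤ ((ε : ℂ) - θ * Complex.I).re := by simpa using hε
  have h2 : 0 ≤ (-((θ : ℂ) * Complex.I)).re := by simp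
  have h3 : 0 ≤ ((ε : ℂ)).re := by simpa using hε
  refine le_trans ?_ (Complex.re_le_norm _)
  unfold lap
  rw [← integral_sub (integrable_one_sub_exp_neg h1) (integrable_one_sub_exp_neg h2),
    ← RCLike.re_eq_complex_re, ← integral_re (integrable_one_sub_exp_neg h3)]
  refine (norm_integral_le_integral_norm _).trans (le_of_eq ?_)
  congr 1
  funext k
  have e1 : Complex.exp (-((ε : ℂ) - θ * Complex.I) * k) =
      Complex.exp (((θ * k : ℝ) : ℂ) * Complex.I) * (Real.exp (-(ε * k)) : ℝ) := by
    push_cast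
    rw [← Complex.exp_add]
    congr 1
    ring
  have e2 : Complex.exp (-(-((θ : ℂ) * Complex.I)) * k) =
      Complex.exp (((θ * k : ℝ) : ℂ) * Complex.I) := by
    push_cast
    congr 1
    ring
  have e3 : Complex.exp (-(ε : ℂ) * k) = (Real.exp (-(ε * k)) : ℝ) := by
    push_cast
    congr 1
    ring
  have e4 : Real.exp (-(ε * k)) ≤ 1 := Real.exp_le_one_iff.2 (by
    have : 0 ≤ ε * k := by positivity
    linarith)
  rw [e1, e2, e3]
  have e5 : ∀ a : ℂ, ∀ r : ℝ, (1 - a * r) - (1 - a) = a * ((1 - r : ℝ) : ℂ) := by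
    intro a r
    push_cast
    ring
  rw [e5, norm_mul, Complex.norm_exp_ofReal_mul_I, one_mul, Complex.norm_real,
    Real.norm_of_nonneg (by linarith), RCLike.re_eq_complex_re, Complex.sub_re, Complex.one_re,
    Complex.ofReal_re]

end lap

namespace RegTail

variable {α : ℝ} {μ : Measure ℕ} [IsProbabilityMeasure μ]

lemma norm_integral_rpow_mul_exp (hα₁ : α < 1) {s : ℂ} (hs : 0 < s.re) :
    ‖∫ x in Set.Ioi (0 : ℝ), ((x ^ (-α) : ℝ) : ℂ) * (s * Complex.exp (-s * x))‖ =
      Real.Gamma (1 - α) * ‖s‖ ^ α := by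
  have hs0 : s ≠ 0 := by
    rintro rfl
    simp at hs
  have h1 := integral_rpow_mul_cexp (a := 1 - α) (by linarith) hs
  have h2 : ∫ x in Set.Ioi (0 : ℝ), ((x ^ (-α) : ℝ) : ℂ) * (s * Complex.exp (-s * x)) =
      s * ∫ x in Set.Ioi (0 : ℝ), ((x ^ ((1 - α) - 1) : ℝ) : ℂ) * Complex.exp (-s * x) := by
    rw [← integral_const_mul]
    congr 1
    funext x
    rw [show 1 - α - 1 = -α by ring]
    ring
  have hn : 0 < ‖s‖ := norm_pos_iff.2 hs0
  rw [h2, h1, norm_mul, norm_mul, ← Complex.ofReal_neg, Complex.norm_cpow_real, Complex.norm_real,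
    Real.norm_of_nonneg (Real.Gamma_pos_of_pos (by linarith)).le, neg_sub, Real.rpow_sub hn,
    Real.rpow_one]
  field_simp

/-- Tail ratios at `n x` are dominated by a power of `x` uniformly in `n`. -/
lemma exists_ratio_bound (h : RegTail α μ) {β : ℝ} (hβ : α < β) (hβ0 : 0 < β) :
    ∃ C : ℝ, 0 < C ∧ ∀ (n : ℕ) (x : ℝ), 0 < x →
      tail μ (n * x) / tail μ n ≤ C * x ^ (-β) + 1 := by
  obtain ⟨c, hc, hp⟩ := h.potter hβ hβ0
  refine ⟨c⁻¹, by positivity, fun n x hx => ?_⟩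
  rcases le_total x 1 with h1 | h1
  · have h2 := hp (n * x) x⁻¹ (by positivity) ((one_le_inv₀ hx).2 h1)
    have h3 : x⁻¹ * (n * x) = n := by field_simp
    rw [h3, Real.inv_rpow hx.le, Real.rpow_neg hx.le, inv_inv] at h2
    have h4 : tail μ (n * x) / tail μ n ≤ c⁻¹ * x ^ (-β) := by
      rw [div_le_iff₀ (h.pos _), Real.rpow_neg hx.le]
      have := Real.rpow_pos_of_pos hx β
      calc tail μ (n * x) = c⁻¹ * (x ^ β)⁻¹ * (c * x ^ β * tail μ (n * x)) := by field_simp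
        _ ≤ _ := by gcongr
    linarith
  · have h2 : tail μ (n * x) / tail μ n ≤ 1 := by
      rw [div_le_one (h.pos _)]
      apply tail_antitone
      have : (0 : ℝ) ≤ n := by positivity
      nlinarith
    have := Real.rpow_pos_of_pos hx (-β)
    have : 0 < c⁻¹ * x ^ (-β) := by positivity
    linarith

/-- Dominated convergence in `∫ tail (n x) / tail n · s exp (-s x) dx`: the ratio tends to `x ^
(-α)`, and choosing `β < 1` keeps the majorant integrable at 0. -/
lemma tendsto_norm_lap (h : RegTail α μ) (hα₀ : 0 < α) (hα₁ : α < 1) {s : ℂ} (hs : 0 < s.re) :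
    Tendsto (fun n : ℕ => ‖lap μ (s / n)‖ / tail μ n) atTop
      (𝓝 (Real.Gamma (1 - α) * ‖s‖ ^ α)) := by
  obtain ⟨β, hβ, hβ₁⟩ := exists_between hα₁
  have hβ0 : 0 < β := hα₀.trans hβ
  obtain ⟨C, hC, hb⟩ := h.exists_ratio_bound hβ hβ0
  rw [← norm_integral_rpow_mul_exp hα₁ hs]
  have key : Tendsto (fun n : ℕ => ∫ x in Set.Ioi (0 : ℝ),
      ((tail μ (n * x) / tail μ n : ℝ) : ℂ) * (s * Complex.exp (-s * x))) atTop
      (𝓝 (∫ x in Set.Ioi (0 : ℝ), ((x ^ (-α) : ℝ) : ℂ) * (s * Complex.exp (-s * x)))) := by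
    refine tendsto_integral_of_dominated_convergence
      (fun x => (C * x ^ (-β) + 1) * (‖s‖ * Real.exp (-s.re * x))) (fun n => ?_) ?_ (fun n => ?_) ?_
    · have hm : Measurable fun x : ℝ => tail μ (n * x) / tail μ n :=
        ((tail_antitone μ).measurable.comp (measurable_const_mul _)).div_const _
      exact ((Complex.measurable_ofReal.comp hm).mul (by fun_prop)).aestronglyMeasurable
    · have i1 : IntegrableOn (fun x : ℝ => x ^ (-β) * Real.exp (-s.re * x)) (Set.Ioi 0) := by
        have := integrableOn_rpow_mul_exp_neg_mul_rpow (s := -β) (p := 1) (b := s.re)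
          (by linarith) one_pos hs
        simpa using this
      have i2 : IntegrableOn (fun x : ℝ => Real.exp (-s.re * x)) (Set.Ioi 0) :=
        exp_neg_integrableOn_Ioi 0 hs
      refine ((i1.const_mul (C * ‖s‖)).add (i2.const_mul ‖s‖)).congr (ae_of_all _ fun x => ?_)
      simp
      ring
    · refine (ae_restrict_iff' measurableSet_Ioi).2 (ae_of_all _ fun x hx => ?_)
      have hx0 : 0 < x := hx
      rw [norm_mul, norm_mul, Complex.norm_exp, Complex.norm_real, Real.norm_of_nonneg
        (div_nonneg (h.pos _).le (h.pos _).le)]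
      have : (-s * x).re = -s.re * x := by simp
      rw [this]
      gcongr
      exact hb n x hx0
    · refine (ae_restrict_iff' measurableSet_Ioi).2 (ae_of_all _ fun x hx => ?_)
      exact ((Complex.continuous_ofReal.tendsto _).comp (h.tendsto_real hx)).mul_const _
  refine key.norm.congr' ?_
  filter_upwards [eventually_ge_atTop 1] with n hn
  have hT := h.pos n
  rw [lap_div_eq hs hn]
  have : ∫ x in Set.Ioi (0 : ℝ), ((tail μ (n * x) / tail μ n : ℝ) : ℂ) * (s * Complex.exp (-s * x)) =
      ((tail μ n)⁻¹ : ℝ) * ∫ x in Set.Ioi (0 : ℝ), (tail μ (n * x) : ℂ) * (s * Complex.exp (-s * x)) := by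
    rw [← integral_const_mul]
    congr 1
    funext x
    push_cast
    ring
  rw [this, norm_mul, Complex.norm_real, Real.norm_of_nonneg (by positivity)]
  ring

/-- Behaviour at scale `1 / n` of the characteristic exponent. -/
lemma tendsto_norm_lap_imag (h : RegTail α μ) (hα₀ : 0 < α) (hα₁ : α < 1) (t : ℝ) :
    Tendsto (fun n : ℕ => ‖lap μ (-((t / n : ℝ) * Complex.I))‖ / tail μ n) atTop
      (𝓝 (Real.Gamma (1 - α) * |t| ^ α)) := by
  have hlim1 : Tendsto (fun ε : ℝ => Real.Gamma (1 - α) * ‖(ε : ℂ) - t * Complex.I‖ ^ α) (𝓝[>] 0)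
      (𝓝 (Real.Gamma (1 - α) * |t| ^ α)) := by
    have : Continuous fun ε : ℝ => Real.Gamma (1 - α) * ‖(ε : ℂ) - t * Complex.I‖ ^ α :=
      continuous_const.mul (Continuous.rpow_const (by fun_prop) fun _ => Or.inr hα₀.le)
    have h2 := (this.tendsto 0).mono_left (nhdsWithin_le_nhds (s := Set.Ioi 0))
    simpa using h2
  have hlim2 : Tendsto (fun ε : ℝ => Real.Gamma (1 - α) * ‖(ε : ℂ)‖ ^ α) (𝓝[>] 0) (𝓝 0) := by
    have : Continuous fun ε : ℝ => Real.Gamma (1 - α) * ‖(ε : ℂ)‖ ^ α :=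
      continuous_const.mul (Continuous.rpow_const (by fun_prop) fun _ => Or.inr hα₀.le)
    have h2 := (this.tendsto 0).mono_left (nhdsWithin_le_nhds (s := Set.Ioi 0))
    simpa [Real.zero_rpow hα₀.ne'] using h2
  rw [Metric.tendsto_atTop]
  intro η hη
  -- The error splits into four parts below `η / 4`: changing the limit from `ε - it` to `-it`, the
  -- limiting size of the shift error, and the convergence at `ε - it` and at `ε` for this fixed
  -- `ε`.
  have e1 := (Metric.tendsto_nhds.1 hlim1) (η / 4) (by positivity)
  have e2 := (Metric.tendsto_nhds.1 hlim2) (η / 4) (by positivity)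
  obtain ⟨ε, ⟨hε1, hε2⟩, hε⟩ := ((e1.and e2).and self_mem_nhdsWithin).exists
  have hε0 : 0 < ε := hε
  have t1 := (Metric.tendsto_nhds.1
    (h.tendsto_norm_lap hα₀ hα₁ (s := (ε : ℂ) - t * Complex.I) (by simpa using hε0))) (η / 4) (by positivity)
  have t2 := (Metric.tendsto_nhds.1
    (h.tendsto_norm_lap hα₀ hα₁ (s := (ε : ℂ)) (by simpa using hε0))) (η / 4) (by positivity)
  obtain ⟨N, hN⟩ := eventually_atTop.1 ((t1.and t2).and (eventually_ge_atTop 1))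
  refine ⟨N, fun n hn => ?_⟩
  obtain ⟨⟨a1, a2⟩, hn1⟩ := hN n hn
  have hn0 : (0 : ℝ) < n := by exact_mod_cast hn1
  have hb := norm_lap_sub_le (μ := μ) (ε := ε / n) (by positivity) (t / n)
  have q1 : ((ε / n : ℝ) : ℂ) - (t / n : ℝ) * Complex.I = ((ε : ℂ) - t * Complex.I) / n := by
    push_cast
    ring
  have q2 : ((ε / n : ℝ) : ℂ) = (ε : ℂ) / n := by push_cast; rfl
  rw [q1, q2] at hb
  have hT := h.pos n
  have hb2 := (abs_norm_sub_norm_le _ _).trans hb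
  have hb3 := div_le_div_of_nonneg_right hb2 hT.le
  have hb4 : |‖lap μ (((ε : ℂ) - t * Complex.I) / n)‖ / tail μ n -
      ‖lap μ (-((t / n : ℝ) * Complex.I))‖ / tail μ n| ≤ ‖lap μ ((ε : ℂ) / n)‖ / tail μ n := by
    rw [← sub_div, abs_div, abs_of_pos hT]
    exact hb3
  rw [Real.dist_eq] at *
  rw [abs_lt] at *
  rw [abs_le] at hb4
  constructor <;> linarith [hb4.1, hb4.2, a1.1, a1.2, a2.1, a2.2, hε1.1, hε1.2, hε2.1, hε2.2]

end RegTail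

/-! ### Zeros of the characteristic exponent and local integrability of its inverse square -/

section lap

variable {μ : Measure ℕ} [IsProbabilityMeasure μ]

lemma re_lap_imag (θ : ℝ) :
    (lap μ (-(θ * Complex.I))).re = ∫ k : ℕ, (1 - Real.cos (θ * k)) ∂μ := by
  rw [lap_re (by simp)]
  simp

lemma integrable_one_sub_cos (θ : ℝ) : Integrable (fun k : ℕ => 1 - Real.cos (θ * k)) μ := by
  have := integrable_lap_re (μ := μ) (s := -(θ * Complex.I)) (by simp)
  simpa using this

lemma re_lap_abs (θ : ℝ) :
    (lap μ (-((|θ| : ℝ) * Complex.I))).re = (lap μ (-(θ * Complex.I))).re := by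
  rw [re_lap_imag, re_lap_imag]
  rcases abs_choice θ with h | h <;> simp [h]

lemma continuous_lap_of_nonneg {f : ℝ → ℂ} (hf : Continuous f) (h0 : ∀ x, 0 ≤ (f x).re) :
    Continuous fun x => lap μ (f x) := by
  unfold lap
  refine continuous_of_dominated (bound := fun _ => 2) (fun x => by fun_prop) (fun x => ?_)
    (integrable_const _) (ae_of_all _ fun k => by fun_prop)
  refine ae_of_all _ fun k => (norm_sub_le _ _).trans ?_
  have := norm_exp_neg_mul_le (h0 x) (x := k) (by positivity)
  simp only [Complex.ofReal_natCast] at this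
  simp only [norm_one]
  linarith

lemma continuous_lap_imag : Continuous fun θ : ℝ => lap μ (-(θ * Complex.I)) :=
  continuous_lap_of_nonneg (by fun_prop) (by simp)

/-- The characteristic exponent is periodic with respect to each of its zeros. -/
lemma re_lap_add_of_eq_zero {θ₀ : ℝ} (h0 : (lap μ (-(θ₀ * Complex.I))).re = 0) (u : ℝ) :
    (lap μ (-((θ₀ + u : ℝ) * Complex.I))).re = (lap μ (-(u * Complex.I))).re := by
  rw [re_lap_imag] at h0 ⊢
  rw [re_lap_imag]
  have h1 := (integral_eq_zero_iff_of_nonneg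
    (fun k : ℕ => sub_nonneg.2 (Real.cos_le_one (θ₀ * k))) (integrable_one_sub_cos θ₀)).1 h0
  refine integral_congr_ae ?_
  filter_upwards [h1] with k hk
  have hc : Real.cos (θ₀ * k) = 1 := by
    simp only [Pi.zero_apply] at hk
    linarith
  have hs : Real.sin (θ₀ * k) = 0 := by
    have := Real.sin_sq_add_cos_sq (θ₀ * k)
    rw [hc] at this
    nlinarith
  rw [add_mul, Real.cos_add, hc, hs]
  ring

end lap

namespace RegTail

variable {α : ℝ} {μ : Measure ℕ} [IsProbabilityMeasure μ]

/-- Lower bound for the real part of the characteristic exponent near the origin. -/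
lemma exists_tail_le_re_lap (h : RegTail α μ) (hα₀ : 0 < α) :
    ∃ c δ : ℝ, 0 < c ∧ 0 < δ ∧ ∀ u : ℝ, 0 < |u| → |u| ≤ δ →
      c * tail μ (1 / |u|) ≤ (lap μ (-(u * Complex.I))).re := by
  obtain ⟨c, hc, hp⟩ := h.potter (β := α + 1) (by linarith) (by linarith)
  have h1 : ((2 : ℕ) : ℝ) ^ (-α) < 1 :=
    Real.rpow_lt_one_of_one_lt_of_neg (by norm_num) (by linarith)
  obtain ⟨κ, hκ, hκ1⟩ := exists_between h1
  obtain ⟨N, hN⟩ := eventually_atTop.1 ((h.tendsto 2 (by norm_num)).eventually (gt_mem_nhds hκ))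
  have hπ := Real.pi_pos
  -- `u ≤ π / 4` keeps `u k` below `3π / 2` for `k < 2n`, with `n = ⌈π / (2u)⌉`; the second bound on
  -- `u` forces `n ≥ N`.
  refine ⟨(1 - κ) * (c * 2 ^ (-(α + 1))), min (Real.pi / 4) (Real.pi / (2 * (N + 1))),
    by have := sub_pos.2 hκ1; positivity, by positivity, ?_⟩
  suffices H : ∀ u : ℝ, 0 < u → u ≤ min (Real.pi / 4) (Real.pi / (2 * (N + 1))) →
      (1 - κ) * (c * 2 ^ (-(α + 1))) * tail μ (1 / u) ≤ (lap μ (-(u * Complex.I))).re by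
    intro u hu0 hu
    rw [← re_lap_abs]
    exact H _ hu0 hu
  intro u hu hud
  have hu1 : u ≤ Real.pi / 4 := hud.trans (min_le_left _ _)
  have hu2 : u ≤ Real.pi / (2 * (N + 1)) := hud.trans (min_le_right _ _)
  set n := ⌈Real.pi / (2 * u)⌉₊ with hn
  have hn1 : Real.pi / (2 * u) ≤ n := Nat.le_ceil _
  have hn2 : (n : ℝ) < Real.pi / (2 * u) + 1 := Nat.ceil_lt_add_one (by positivity)
  have hnN : N ≤ n := by
    have : (N : ℝ) ≤ Real.pi / (2 * u) := by
      rw [le_div_iff₀ (by positivity)] at hu2 ⊢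
      nlinarith
    exact_mod_cast this.trans hn1
  have h2 := (hN n hnN).le
  rw [div_le_iff₀ (h.pos _)] at h2
  -- Potter with ratio 2: `π / (2u) ≤ 2 / u` because `π ≤ 4`.
  have h3 : c * 2 ^ (-(α + 1)) * tail μ (1 / u) ≤ tail μ n := by
    refine (hp (1 / u) 2 (by positivity) (by norm_num)).trans ?_
    rw [hn, tail_ceil]
    apply tail_antitone
    rw [mul_one_div, div_le_div_iff₀ (by positivity) hu]
    nlinarith [Real.pi_le_four]
  -- For `n ≤ k < 2n` the angle `u k` lies where the cosine is nonpositive, so `1 - cos (u k) ≥ 1`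
  -- on an event of probability `tail n - tail (2n)`.
  have h4 : tail μ n - tail μ (2 * n : ℕ) ≤ (lap μ (-(u * Complex.I))).re := by
    rw [re_lap_imag, tail_natCast, tail_natCast, ← measureReal_sdiff
      (Set.Ici_subset_Ici.2 (by omega)) MeasurableSet.of_discrete, ← mul_one (μ.real _),
      ← smul_eq_mul, ← integral_indicator_const _ MeasurableSet.of_discrete]
    refine integral_mono ((integrable_const _).indicator MeasurableSet.of_discrete)
      (integrable_one_sub_cos u) fun k => ?_
    by_cases hk : k ∈ Set.Ici n \ Set.Ici (2 * n)
    · rw [Set.indicator_of_mem hk]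
      simp only [Set.mem_sdiff, Set.mem_Ici, not_le] at hk
      have k1 : (n : ℝ) ≤ k := by exact_mod_cast hk.1
      have k2 : (k : ℝ) + 1 ≤ 2 * n := by exact_mod_cast hk.2
      have e : Real.pi / (2 * u) * u = Real.pi / 2 := by field_simp
      have k3 : Real.cos (u * k) ≤ 0 := by
        apply Real.cos_nonpos_of_pi_div_two_le_of_le
        · nlinarith
        · nlinarith
      linarith
    · rw [Set.indicator_of_notMem hk]
      linarith [Real.cos_le_one (u * k)]
  have h5 : 0 < 1 - κ := sub_pos.2 hκ1
  calc (1 - κ) * (c * 2 ^ (-(α + 1))) * tail μ (1 / u)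
      = (1 - κ) * (c * 2 ^ (-(α + 1)) * tail μ (1 / u)) := by ring
    _ ≤ (1 - κ) * tail μ n := by gcongr
    _ ≤ _ := by linarith

lemma exists_rpow_le_re_lap (h : RegTail α μ) (hα₀ : 0 < α) {β : ℝ} (hβ : α < β) :
    ∃ c δ : ℝ, 0 < c ∧ 0 < δ ∧ ∀ u : ℝ, 0 < |u| → |u| ≤ δ →
      c * |u| ^ β ≤ (lap μ (-(u * Complex.I))).re := by
  obtain ⟨c₁, δ, hc₁, hδ, h1⟩ := h.exists_tail_le_re_lap hα₀
  obtain ⟨c₂, hc₂, h2⟩ := h.potter hβ (hα₀.trans hβ)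
  have hT := h.pos 1
  refine ⟨c₁ * (c₂ * tail μ 1), min δ 1, by positivity, by positivity, fun u hu0 hu => ?_⟩
  have h3 := h2 1 (1 / |u|) zero_le_one ((one_le_div hu0).2 (hu.trans (min_le_right _ _)))
  rw [mul_one, one_div, Real.inv_rpow hu0.le, Real.rpow_neg hu0.le, inv_inv] at h3
  have h4 := h1 u hu0 (hu.trans (min_le_left _ _))
  rw [one_div] at h4
  refine le_trans ?_ h4
  calc c₁ * (c₂ * tail μ 1) * |u| ^ β = c₁ * (c₂ * |u| ^ β * tail μ 1) := by ring
    _ ≤ _ := by gcongr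

/-- A lattice `μ` can have zeros besides 0. Translation by a zero preserves the real part, so each
zero looks like the origin, where the power lower bound makes it isolated. -/
lemma re_lap_zeros_null (h : RegTail α μ) (hα₀ : 0 < α) :
    volume {θ : ℝ | (lap μ (-(θ * Complex.I))).re = 0} = 0 := by
  obtain ⟨c, δ, hc, hδ, h1⟩ := h.exists_rpow_le_re_lap hα₀ (lt_add_one α)
  refine measure_null_of_locally_null _ fun θ₀ h0 => ?_
  refine ⟨{θ : ℝ | (lap μ (-(θ * Complex.I))).re = 0} ∩ Metric.closedBall θ₀ δ,
    inter_mem_nhdsWithin _ (Metric.closedBall_mem_nhds θ₀ hδ), ?_⟩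
  refine measure_mono_null (t := {θ₀}) ?_ (by simp)
  rintro θ ⟨hθ, hd⟩
  by_contra hne
  have hu0 : 0 < |θ - θ₀| := abs_pos.2 (sub_ne_zero.2 hne)
  have h2 := h1 (θ - θ₀) hu0 (by simpa [Real.dist_eq] using hd)
  rw [← re_lap_add_of_eq_zero h0, add_sub_cancel] at h2
  have h3 : 0 < c * |θ - θ₀| ^ (α + 1) := by positivity
  have h4 : (lap μ (-(θ * Complex.I))).re = 0 := hθ
  linarith

lemma intervalIntegrable_abs_rpow {r : ℝ} (hr : -1 < r) (a b : ℝ) :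
    IntervalIntegrable (fun x : ℝ => |x| ^ r) volume a b := by
  refine intervalIntegrable_of_even (fun x => by simp) (fun x hx => ?_)
  refine (intervalIntegral.intervalIntegrable_rpow' hr (a := 0) (b := x)).congr ?_
  intro y hy
  rw [Set.uIoc_of_le hx.le] at hy
  simp [abs_of_pos hy.1]

/-- Near any zero the inverse square is at most a multiple of `|u| ^ (-2β)` with `α < β < 1/2`,
hence integrable; elsewhere it is continuous. This is where `α < 1/2` is essential. -/
lemma locallyIntegrable_inv_sq (h : RegTail α μ) (hα₀ : 0 < α) (hα : α < 1 / 2) :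
    LocallyIntegrable fun θ : ℝ => ((lap μ (-(θ * Complex.I))).re ^ 2)⁻¹ := by
  obtain ⟨β, hβ, hβ1⟩ := exists_between hα
  obtain ⟨c, δ, hc, hδ, h1⟩ := h.exists_rpow_le_re_lap hα₀ hβ
  have hcont : Continuous fun θ : ℝ => (lap μ (-(θ * Complex.I))).re :=
    Complex.continuous_re.comp continuous_lap_imag
  have hmeas : Measurable fun θ : ℝ => ((lap μ (-(θ * Complex.I))).re ^ 2)⁻¹ :=
    (hcont.measurable.pow_const 2).inv
  intro θ₀
  by_cases h0 : (lap μ (-(θ₀ * Complex.I))).re = 0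
  · refine ⟨Metric.closedBall θ₀ δ, Metric.closedBall_mem_nhds θ₀ hδ, ?_⟩
    have h2 : IntegrableOn (fun u : ℝ => (c ^ 2)⁻¹ * |u| ^ (-(2 * β))) (Set.Icc (-δ) δ) := by
      have := (intervalIntegrable_abs_rpow (r := -(2 * β)) (by linarith) (-δ) δ).1
      rw [← integrableOn_Icc_iff_integrableOn_Ioc] at this
      exact this.const_mul _
    have h3 : IntegrableOn (fun u : ℝ => ((lap μ (-(u * Complex.I))).re ^ 2)⁻¹) (Set.Icc (-δ) δ) := by
      refine h2.mono' hmeas.aestronglyMeasurable ?_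
      have hne : ∀ᵐ u : ℝ ∂(volume.restrict (Set.Icc (-δ) δ)), u ≠ 0 :=
        ae_restrict_of_ae (Measure.ae_ne volume 0)
      filter_upwards [hne, ae_restrict_mem measurableSet_Icc] with u hu hud
      have hu0 : 0 < |u| := abs_pos.2 hu
      have h4 := h1 u hu0 (abs_le.2 hud)
      rw [Real.norm_of_nonneg (by positivity), Real.rpow_neg hu0.le, ← mul_inv]
      have h5 : |u| ^ (2 * β) = (|u| ^ β) ^ 2 := by
        rw [mul_comm, Real.rpow_mul hu0.le]
        norm_cast
      rw [h5, ← mul_pow]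
      have : 0 < c * |u| ^ β := by positivity
      gcongr
    have h4 : IntegrableOn (fun θ : ℝ => ((lap μ (-((θ - θ₀ : ℝ) * Complex.I))).re ^ 2)⁻¹)
        (Metric.closedBall θ₀ δ) := by
      have hp := (measurePreserving_sub_right volume θ₀).integrableOn_comp_preimage
        (MeasurableEquiv.subRight θ₀).measurableEmbedding
        (f := fun u : ℝ => ((lap μ (-(u * Complex.I))).re ^ 2)⁻¹) (s := Set.Icc (-δ) δ)
      have hs : (fun x => x - θ₀) ⁻¹' Set.Icc (-δ) δ = Metric.closedBall θ₀ δ := by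
        rw [Real.closedBall_eq_Icc]
        simp [add_comm, sub_eq_add_neg]
      rw [hs] at hp
      exact hp.2 h3
    refine h4.congr (ae_of_all _ fun θ => ?_)
    have := re_lap_add_of_eq_zero h0 (θ - θ₀)
    rw [add_sub_cancel] at this
    simp only [this]
  · have hc : ContinuousAt (fun θ : ℝ => ((lap μ (-(θ * Complex.I))).re ^ 2)⁻¹) θ₀ :=
      (hcont.continuousAt.pow 2).inv₀ (pow_ne_zero 2 h0)
    exact hc.tendsto.integrableAtFilter hmeas.aestronglyMeasurable.stronglyMeasurableAtFilter
      (volume.finiteAt_nhds θ₀)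

end RegTail

/-! ### Independence of one coordinate under the product measure -/

section product

variable {ι : Type*} [DecidableEq ι] (μ : Measure ℕ) [IsProbabilityMeasure μ]

/-- Resampling one coordinate preserves an i.i.d. product measure. -/
lemma map_update_infinitePi (i : ι) :
    ((Measure.infinitePi fun _ : ι => μ).prod μ).map (fun p => Function.update p.1 i p.2) =
      Measure.infinitePi fun _ : ι => μ := by
  have hm : Measurable fun p : (ι → ℕ) × ℕ => Function.update p.1 i p.2 := measurable_update'
  refine Measure.eq_infinitePi _ fun s t ht => ?_
  rw [Measure.map_apply hm (MeasurableSet.pi s.countable_toSet fun l _ => ht l)]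
  have hpre : (fun p : (ι → ℕ) × ℕ => Function.update p.1 i p.2) ⁻¹' (Set.pi s t) =
      (Set.pi (s.erase i : Finset ι) t) ×ˢ {x | i ∈ s → x ∈ t i} := by
    ext ⟨k, x⟩
    simp only [Set.mem_preimage, Set.mem_pi, Set.mem_prod, Finset.mem_coe, Finset.mem_erase,
      Set.mem_ofPred_eq]
    constructor
    · intro h
      refine ⟨fun l hl => by simpa [hl.1] using h l hl.2, fun hi => by simpa using h i hi⟩
    · rintro ⟨h1, h2⟩ l hl
      by_cases hli : l = i
      · subst hli
        simpa using h2 hl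
      · simpa [hli] using h1 l ⟨hli, hl⟩
  rw [hpre, Measure.prod_prod, Measure.infinitePi_pi _ (fun l _ => ht l)]
  by_cases hi : i ∈ s
  · simp only [hi, forall_const]
    rw [mul_comm]
    exact Finset.mul_prod_erase s (fun l => μ (t l)) hi
  · simp [hi]

/-- Invariance under `Function.update` says that `E` does not depend on coordinate `i`, hence is
independent of it. Both first-step decompositions, for renewals and for ancestral lines, rest on
this. -/
lemma infinitePi_inter_eval (i : ι) (m : ℕ) {E : Set (ι → ℕ)} (hE : MeasurableSet E)
    (hinv : ∀ (k : ι → ℕ) (x : ℕ), Function.update k i x ∈ E ↔ k ∈ E) :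
    (Measure.infinitePi fun _ : ι => μ).real ({k | k i = m} ∩ E) =
      μ.real {m} * (Measure.infinitePi fun _ : ι => μ).real E := by
  have hm : Measurable fun p : (ι → ℕ) × ℕ => Function.update p.1 i p.2 := measurable_update'
  have hmi : MeasurableSet {k : ι → ℕ | k i = m} :=
    measurableSet_eq_fun (measurable_pi_apply i) measurable_const
  conv_lhs => rw [← map_update_infinitePi μ i]
  rw [map_measureReal_apply hm (hmi.inter hE)]
  have hpre : (fun p : (ι → ℕ) × ℕ => Function.update p.1 i p.2) ⁻¹' ({k | k i = m} ∩ E) =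
      E ×ˢ {m} := by
    ext ⟨k, x⟩
    simp [hinv, and_comm]
  rw [hpre, measureReal_prod_prod, mul_comm]

end product

/-! ### The renewal sequence and its generating function -/

section renewal

variable (μ : Measure ℕ) [IsProbabilityMeasure μ]

/-- The event that `n` is one of the partial sums, the empty one included. -/
def hit (n : ℕ) : Set (ℕ → ℕ) := {X | ∃ j, ∑ i ∈ Finset.range j, X i = n}

lemma measurableSet_hit (n : ℕ) : MeasurableSet (hit n) := by
  have : hit n = ⋃ j : ℕ, (fun X : ℕ → ℕ => ∑ i ∈ Finset.range j, X i) ⁻¹' {n} := by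
    ext X
    simp [hit]
  rw [this]
  refine MeasurableSet.iUnion fun j => ?_
  have : Measurable fun X : ℕ → ℕ => ∑ i ∈ Finset.range j, X i := by fun_prop
  exact this (MeasurableSet.singleton n)

/-- Admitting the empty sum accounts exactly for the convention `q 0 = 1` and changes nothing for `n
≥ 1`. -/
lemma q_eq_hit (n : ℕ) : q μ n = (Measure.infinitePi fun _ : ℕ => μ).real (hit n) := by
  unfold q
  split_ifs with h
  · subst h
    have : hit 0 = Set.univ := by
      ext X
      simp only [hit, Set.mem_ofPred_eq, Set.mem_univ, iff_true]
      exact ⟨0, by simp⟩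
    rw [this]
    simp
  · congr 1
    ext X
    simp only [hit, renewalSet, Set.mem_ofPred_eq]
    constructor
    · rintro ⟨j, _, hj⟩
      exact ⟨j, hj⟩
    · rintro ⟨j, hj⟩
      refine ⟨j, ?_, hj⟩
      rcases j with _ | j
      · simp at hj
        exact absurd hj.symm h
      · omega

lemma q_zero : q μ 0 = 1 := by simp [q]

lemma q_nonneg (n : ℕ) : 0 ≤ q μ n := by
  rw [q_eq_hit]
  exact measureReal_nonneg

lemma q_le_one (n : ℕ) : q μ n ≤ 1 := by
  rw [q_eq_hit]
  exact measureReal_le_one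

/-- The renewal equation. -/
lemma q_renewal {n : ℕ} (hn : 1 ≤ n) :
    q μ n = ∑ k ∈ Finset.range (n + 1), μ.real {k} * q μ (n - k) := by
  set P := Measure.infinitePi fun _ : ℕ => μ with hP
  let E : ℕ → Set (ℕ → ℕ) := fun m => (fun (X : ℕ → ℕ) l => X (l + 1)) ⁻¹' hit m
  have hEm : ∀ m, MeasurableSet (E m) := fun m =>
    (by fun_prop : Measurable fun (X : ℕ → ℕ) (l : ℕ) => X (l + 1)) (measurableSet_hit m)
  have hE : ∀ m, P.real (E m) = q μ m := by
    intro m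
    have h1 := Measure.map_infinitePi_infinitePi_of_inj (P := fun _ : ℕ => μ)
      (f := Nat.succ) Nat.succ_injective
    rw [q_eq_hit, ← hP]
    conv_rhs => rw [hP, ← h1]
    rw [map_measureReal_apply (by fun_prop) (measurableSet_hit m)]
  -- Decomposition by the first step `X 0 = k`; it is at most `n`, so the natural subtraction is not
  -- truncated.
  have hdec : hit n = ⋃ k ∈ Finset.range (n + 1), ({X | X 0 = k} ∩ E (n - k)) := by
    ext X
    simp only [Set.mem_iUnion, Finset.mem_range, E, hit, Set.mem_inter_iff, Set.mem_preimage,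
      Set.mem_ofPred_eq, exists_prop]
    constructor
    · rintro ⟨j, hj⟩
      rcases j with _ | j
      · simp at hj
        omega
      · rw [Finset.sum_range_succ'] at hj
        exact ⟨X 0, by omega, rfl, j, by omega⟩
    · rintro ⟨k, hk, h0, j, hj⟩
      refine ⟨j + 1, ?_⟩
      rw [Finset.sum_range_succ', hj]
      omega
  rw [q_eq_hit, hdec, measureReal_biUnion_finset]
  · refine Finset.sum_congr rfl fun k _ => ?_
    rw [infinitePi_inter_eval μ 0 k (hEm _) (fun X x => by simp [E]), ← hP, hE]
  · intro a _ b _ hab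
    refine Set.disjoint_left.2 fun X h1 h2 => hab ?_
    exact h1.1.symm.trans h2.1
  · exact fun k _ => (measurableSet_eq_fun (measurable_pi_apply 0) measurable_const).inter (hEm _)

lemma norm_exp_neg_mul_nat {s : ℂ} (n : ℕ) :
    ‖Complex.exp (-s * n)‖ = Real.exp (-s.re) ^ n := by
  rw [Complex.norm_exp, ← Real.exp_nat_mul]
  congr 1
  simp
  ring

lemma summable_geom_of_bdd {a : ℕ → ℝ} {C : ℝ} (ha : ∀ n, |a n| ≤ C) {s : ℂ} (hs : 0 < s.re) :
    Summable fun n : ℕ => ‖(a n : ℂ) * Complex.exp (-s * n)‖ := by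
  have h1 : Summable fun n : ℕ => C * Real.exp (-s.re) ^ n :=
    (summable_geometric_of_lt_one (Real.exp_pos _).le (by simpa using hs)).mul_left _
  refine h1.of_nonneg_of_le (fun _ => norm_nonneg _) fun n => ?_
  rw [norm_mul, norm_exp_neg_mul_nat, Complex.norm_real]
  gcongr
  exact ha n

lemma abs_q_le_one (n : ℕ) : |q μ n| ≤ 1 := by
  rw [abs_of_nonneg (q_nonneg μ n)]
  exact q_le_one μ n

/-- The generating function of the renewal sequence. -/
lemma tsum_q_mul_lap (hμ₀ : μ {0} = 0) {s : ℂ} (hs : 0 < s.re) :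
    (∑' n : ℕ, (q μ n : ℂ) * Complex.exp (-s * n)) * lap μ s = 1 := by
  have hq := summable_geom_of_bdd (abs_q_le_one μ) hs
  have hw : Summable fun n : ℕ => ‖((μ.real {n} : ℝ) : ℂ) * Complex.exp (-s * n)‖ :=
    summable_geom_of_bdd (C := 1) (fun n => by
      rw [abs_of_nonneg measureReal_nonneg]
      exact measureReal_le_one) hs
  have hlap : lap μ s = 1 - ∑' n : ℕ, ((μ.real {n} : ℝ) : ℂ) * Complex.exp (-s * n) := by
    rw [lap, integral_sub (integrable_const _) (integrable_exp_neg hs.le),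
      integral_countable (integrable_exp_neg hs.le)]
    simp
  have hprod := tsum_mul_tsum_eq_tsum_sum_antidiagonal_of_summable_norm hw hq
  -- The convolution of `μ` with `q` returns `q` except at `n = 0`, where it is 0 while `q 0 = 1`;
  -- this defect is the 1 on the right of the identity.
  have hterm : ∀ n : ℕ, (∑ kl ∈ Finset.HasAntidiagonal.antidiagonal n,
      (((μ.real {kl.1} : ℝ) : ℂ) * Complex.exp (-s * kl.1)) *
        ((q μ kl.2 : ℂ) * Complex.exp (-s * kl.2))) =
      (q μ n : ℂ) * Complex.exp (-s * n) - if n = 0 then 1 else 0 := by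
    intro n
    have h1 : ∀ kl ∈ Finset.HasAntidiagonal.antidiagonal n, (((μ.real {kl.1} : ℝ) : ℂ) * Complex.exp (-s * kl.1)) *
        ((q μ kl.2 : ℂ) * Complex.exp (-s * kl.2)) =
        ((μ.real {kl.1} * q μ kl.2 : ℝ) : ℂ) * Complex.exp (-s * n) := by
      intro kl hkl
      have h2 : Complex.exp (-s * n) = Complex.exp (-s * kl.1) * Complex.exp (-s * kl.2) := by
        rw [← Complex.exp_add, ← Finset.HasAntidiagonal.mem_antidiagonal.1 hkl]
        congr 1
        push_cast
        ring
      rw [h2]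
      push_cast
      ring
    rw [Finset.sum_congr rfl h1, ← Finset.sum_mul, ← Complex.ofReal_sum,
      Finset.Nat.sum_antidiagonal_eq_sum_range_succ (fun a b => μ.real {a} * q μ b)]
    rcases Nat.eq_zero_or_pos n with rfl | hn
    · simp [q_zero, measureReal_def, hμ₀]
    · rw [← q_renewal μ hn]
      simp [hn.ne']
  have hdelta : HasSum (fun n : ℕ => if n = 0 then (1 : ℂ) else 0) 1 := hasSum_ite_eq 0 1
  rw [tsum_congr hterm, hq.of_norm.tsum_sub hdelta.summable, hdelta.tsum_eq] at hprod
  rw [hlap, mul_sub, mul_one, mul_comm, hprod]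
  ring

end renewal

/-! ### Parseval and the spectral representation of block sums -/

lemma integral_cexp_int (k : ℤ) :
    ∫ θ in (-Real.pi)..Real.pi, Complex.exp (((k : ℂ) * Complex.I) * θ) =
      if k = 0 then (2 * Real.pi : ℂ) else 0 := by
  split_ifs with hk
  · subst hk
    simp
    ring
  · have hk' : (k : ℂ) * Complex.I ≠ 0 := mul_ne_zero (by exact_mod_cast hk) Complex.I_ne_zero
    rw [integral_exp_mul_complex hk']
    have : Complex.exp ((k : ℂ) * Complex.I * (Real.pi : ℝ)) =
        Complex.exp ((k : ℂ) * Complex.I * (-Real.pi : ℝ)) := by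
      rw [Complex.exp_eq_exp_iff_exists_int]
      refine ⟨k, ?_⟩
      push_cast
      ring
    rw [this, sub_self, zero_div]

/-- Parseval's identity for absolutely summable real sequences. -/
lemma integral_norm_sq_tsum {a : ℕ → ℝ} (ha : Summable fun n => |a n|) :
    ∫ θ in (-Real.pi)..Real.pi, ‖∑' n : ℕ, (a n : ℂ) * Complex.exp (θ * Complex.I * n)‖ ^ 2 =
      2 * Real.pi * ∑' n, a n ^ 2 := by
  have hnorm : ∀ (θ : ℝ) (n : ℕ), ‖(a n : ℂ) * Complex.exp (θ * Complex.I * n)‖ = |a n| := by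
    intro θ n
    have : (θ : ℂ) * Complex.I * n = ((θ * n : ℝ) : ℂ) * Complex.I := by
      push_cast
      ring
    rw [norm_mul, this, Complex.norm_exp_ofReal_mul_I, mul_one, Complex.norm_real, Real.norm_eq_abs]
  have hs : ∀ θ : ℝ, Summable fun n => ‖(a n : ℂ) * Complex.exp (θ * Complex.I * n)‖ := by
    intro θ
    simpa only [hnorm] using ha
  have hprod : Summable fun p : ℕ × ℕ => |a p.1| * |a p.2| :=
    ha.mul_of_nonneg ha (fun _ => abs_nonneg _) fun _ => abs_nonneg _
  -- The squared modulus is expanded as an absolutely convergent double series; after termwise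
  -- integration, orthogonality leaves the diagonal.
  let F : ℕ × ℕ → ℝ → ℂ := fun p θ =>
    ((a p.1 * a p.2 : ℝ) : ℂ) * Complex.exp (((((p.1 : ℤ) - p.2 : ℤ) : ℂ) * Complex.I) * θ)
  have hF : ∀ (θ : ℝ) (p : ℕ × ℕ), F p θ = ((a p.1 : ℂ) * Complex.exp (θ * Complex.I * p.1)) *
      (starRingEnd ℂ) ((a p.2 : ℂ) * Complex.exp (θ * Complex.I * p.2)) := by
    intro θ p
    rw [map_mul, ← Complex.exp_conj]
    simp only [F, map_mul, Complex.conj_ofReal, Complex.conj_I, Complex.conj_natCast]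
    rw [mul_mul_mul_comm, ← Complex.exp_add]
    push_cast
    congr 2
    ring
  have hFn : ∀ (θ : ℝ) (p : ℕ × ℕ), ‖F p θ‖ = |a p.1| * |a p.2| := by
    intro θ p
    rw [hF, norm_mul, RCLike.norm_conj, hnorm, hnorm]
  have hsum : HasSum (fun p => ∫ θ in (-Real.pi)..Real.pi, F p θ)
      (∫ θ in (-Real.pi)..Real.pi,
        ((‖∑' n : ℕ, (a n : ℂ) * Complex.exp (θ * Complex.I * n)‖ ^ 2 : ℝ) : ℂ)) := by
    refine intervalIntegral.hasSum_integral_of_dominated_convergence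
      (fun p _ => |a p.1| * |a p.2|) (fun p => ?_) (fun p => ?_) ?_ ?_ ?_
    · exact Continuous.aestronglyMeasurable (by fun_prop)
    · exact ae_of_all _ fun θ _ => (hFn θ p).le
    · exact ae_of_all _ fun θ _ => hprod
    · exact intervalIntegrable_const
    · refine ae_of_all _ fun θ _ => ?_
      have h1 : Summable fun n =>
          ‖(starRingEnd ℂ) ((a n : ℂ) * Complex.exp (θ * Complex.I * n))‖ := by
        simpa only [RCLike.norm_conj] using hs θ
      have h2 := summable_mul_of_summable_norm (hs θ) h1
      have h3 := tsum_mul_tsum_of_summable_norm (hs θ) h1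
      rw [← Complex.conj_tsum, Complex.mul_conj'] at h3
      have h4 := h2.hasSum
      rw [← h3] at h4
      push_cast
      refine h4.congr_fun fun p => ?_
      exact hF θ p
  have hval : ∀ p : ℕ × ℕ, ∫ θ in (-Real.pi)..Real.pi, F p θ =
      if p.1 = p.2 then ((a p.1 ^ 2 * (2 * Real.pi) : ℝ) : ℂ) else 0 := by
    intro p
    simp only [F]
    rw [intervalIntegral.integral_const_mul, integral_cexp_int]
    by_cases h : p.1 = p.2
    · simp [h]
      ring
    · have : (p.1 : ℤ) - p.2 ≠ 0 := by omega
      simp [h, this]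
  simp_rw [hval] at hsum
  have hdiag : Function.Injective fun n : ℕ => (n, n) := fun m n h => (Prod.mk.inj h).1
  rw [← hdiag.hasSum_iff] at hsum
  · have h5 : HasSum (fun n => ((a n ^ 2 * (2 * Real.pi) : ℝ) : ℂ)) _ :=
      hsum.congr_fun fun n => by simp
    rw [intervalIntegral.integral_ofReal, Complex.hasSum_ofReal] at h5
    rw [← h5.tsum_eq, tsum_mul_right, mul_comm]
  · rintro ⟨m, n⟩ h
    have : m ≠ n := by
      rintro rfl
      exact h ⟨m, rfl⟩
    simp [this]

/-- The renewal sequence delayed by `j`. -/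
def delayed (μ : Measure ℕ) [IsProbabilityMeasure μ] (j t : ℕ) : ℝ :=
  if j ≤ t then q μ (t - j) else 0

/-- The expected number of renewals in a window of length `n`. -/
def block (μ : Measure ℕ) [IsProbabilityMeasure μ] (n t : ℕ) : ℝ :=
  ∑ j ∈ Finset.range n, delayed μ j t

section block

variable (μ : Measure ℕ) [IsProbabilityMeasure μ]

lemma delayed_nonneg (j t : ℕ) : 0 ≤ delayed μ j t := by
  unfold delayed
  split_ifs
  · exact q_nonneg μ _
  · exact le_rfl

lemma delayed_le_one (j t : ℕ) : delayed μ j t ≤ 1 := by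
  unfold delayed
  split_ifs
  · exact q_le_one μ _
  · exact zero_le_one

lemma block_nonneg (n t : ℕ) : 0 ≤ block μ n t :=
  Finset.sum_nonneg fun j _ => delayed_nonneg μ j t

lemma abs_block_le (n t : ℕ) : |block μ n t| ≤ n := by
  rw [abs_of_nonneg (block_nonneg μ n t)]
  calc block μ n t ≤ ∑ _j ∈ Finset.range n, (1 : ℝ) :=
        Finset.sum_le_sum fun j _ => delayed_le_one μ j t
    _ = n := by simp

lemma block_one (t : ℕ) : block μ 1 t = q μ t := by
  simp [block, delayed]

/-- A delay by `j` multiplies the transform by `exp (-s j)`, so the window contributes a geometric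
sum. -/
lemma tsum_block_mul (n : ℕ) {s : ℂ} (hs : 0 < s.re) :
    ∑' t : ℕ, (block μ n t : ℂ) * Complex.exp (-s * t) =
      (∑ j ∈ Finset.range n, Complex.exp (-s * j)) *
        ∑' t : ℕ, (q μ t : ℂ) * Complex.exp (-s * t) := by
  have hq := (summable_geom_of_bdd (abs_q_le_one μ) hs).of_norm.hasSum
  have hj : ∀ j : ℕ, HasSum (fun t : ℕ => (delayed μ j t : ℂ) * Complex.exp (-s * t))
      (Complex.exp (-s * j) * ∑' t : ℕ, (q μ t : ℂ) * Complex.exp (-s * t)) := by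
    intro j
    rw [← (add_left_injective j).hasSum_iff]
    · refine (hq.mul_left (Complex.exp (-s * j))).congr_fun fun t => ?_
      have : -s * ((t + j : ℕ) : ℂ) = -s * j + -s * t := by
        push_cast
        ring
      simp only [Function.comp, delayed, le_add_iff_nonneg_left, zero_le, if_true,
        Nat.add_sub_cancel, this, Complex.exp_add]
      ring
    · intro t ht
      have : ¬ j ≤ t := fun h => ht ⟨t - j, Nat.sub_add_cancel h⟩
      simp [delayed, this]
  rw [Finset.sum_mul, ← (hasSum_sum fun j _ => hj j).tsum_eq]
  refine tsum_congr fun t => ?_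
  rw [block, Complex.ofReal_sum, Finset.sum_mul]

end block

section spectral

variable {α : ℝ} {μ : Measure ℕ} [IsProbabilityMeasure μ]

/-- Absolute summability is not known for the block sums themselves; the damping supplies it, so
Parseval applies at `s = ε - iθ`, where the transform of `q` is `1 / lap`. -/
lemma tsum_block_sq_damped (hμ₀ : μ {0} = 0) (n : ℕ) {ε : ℝ} (hε : 0 < ε) :
    ∑' t : ℕ, (block μ n t * Real.exp (-ε * t)) ^ 2 = (2 * Real.pi)⁻¹ *
      ∫ θ in (-Real.pi)..Real.pi,
        ‖∑ j ∈ Finset.range n, Complex.exp (-((ε : ℂ) - θ * Complex.I) * j)‖ ^ 2 /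
          ‖lap μ (ε - θ * Complex.I)‖ ^ 2 := by
  have hsum : Summable fun t : ℕ => |block μ n t * Real.exp (-ε * t)| := by
    have := summable_geom_of_bdd (abs_block_le μ n) (s := (ε : ℂ)) (by simpa using hε)
    refine this.congr fun t => ?_
    rw [norm_mul, abs_mul, Complex.norm_real, Complex.norm_exp, Real.norm_eq_abs, Real.abs_exp]
    simp
  have hP := integral_norm_sq_tsum hsum
  have hpi : (2 * Real.pi) ≠ 0 := by positivity
  rw [eq_inv_mul_iff_mul_eq₀ hpi, ← hP]
  refine intervalIntegral.integral_congr fun θ _ => ?_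
  have hs : 0 < ((ε : ℂ) - θ * Complex.I).re := by simpa using hε
  have h1 := tsum_q_mul_lap μ hμ₀ hs
  have h2 := tsum_block_mul μ n hs
  have h3 : ∑' t : ℕ, ((block μ n t * Real.exp (-ε * t) : ℝ) : ℂ) * Complex.exp (θ * Complex.I * t) =
      ∑' t : ℕ, (block μ n t : ℂ) * Complex.exp (-((ε : ℂ) - θ * Complex.I) * t) := by
    refine tsum_congr fun t => ?_
    push_cast
    rw [mul_assoc, ← Complex.exp_add]
    congr 2
    ring
  have h4 : lap μ (ε - θ * Complex.I) ≠ 0 := right_ne_zero_of_mul_eq_one h1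
  rw [h3, h2, eq_inv_of_mul_eq_one_left h1, norm_mul, norm_inv, mul_pow, inv_pow, div_eq_mul_inv]

lemma norm_sum_exp_le (n : ℕ) {s : ℂ} (hs : 0 ≤ s.re) :
    ‖∑ j ∈ Finset.range n, Complex.exp (-s * j)‖ ≤ n := by
  refine (norm_sum_le _ _).trans ?_
  calc ∑ j ∈ Finset.range n, ‖Complex.exp (-s * j)‖ ≤ ∑ _j ∈ Finset.range n, (1 : ℝ) :=
        Finset.sum_le_sum fun j _ => by
          simpa using norm_exp_neg_mul_le hs (x := j) (by positivity)
    _ = n := by simp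

lemma RegTail.intervalIntegrable_inv_sq (h : RegTail α μ) (hα₀ : 0 < α) (hα : α < 1 / 2) (a b : ℝ) :
    IntervalIntegrable (fun θ : ℝ => ((lap μ (-(θ * Complex.I))).re ^ 2)⁻¹) volume a b :=
  ((h.locallyIntegrable_inv_sq hα₀ hα).integrableOn_isCompact isCompact_uIcc).intervalIntegrable

/-- The spectral representation of the sum of the squares of the block sums of the renewal
sequence. -/
lemma RegTail.hasSum_block_sq (h : RegTail α μ) (hα₀ : 0 < α) (hα : α < 1 / 2)
    (hμ₀ : μ {0} = 0) (n : ℕ) :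
    HasSum (fun t : ℕ => block μ n t ^ 2) ((2 * Real.pi)⁻¹ *
      ∫ θ in (-Real.pi)..Real.pi,
        ‖∑ j ∈ Finset.range n, Complex.exp (θ * Complex.I * j)‖ ^ 2 /
          ‖lap μ (-(θ * Complex.I))‖ ^ 2) := by
  have hpi := Real.pi_pos
  have hne : ∀ᵐ θ : ℝ, (lap μ (-(θ * Complex.I))).re ≠ 0 := by
    rw [ae_iff]
    simpa using h.re_lap_zeros_null hα₀
  -- A majorant independent of `ε`, integrable by `intervalIntegrable_inv_sq`; the 4 is the square
  -- of the 2 in `half_re_lap_le`.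
  have hbound : ∀ ε : ℝ, 0 < ε → ∀ θ : ℝ, (lap μ (-(θ * Complex.I))).re ≠ 0 →
      ‖∑ j ∈ Finset.range n, Complex.exp (-((ε : ℂ) - θ * Complex.I) * j)‖ ^ 2 /
          ‖lap μ (ε - θ * Complex.I)‖ ^ 2 ≤
        (n : ℝ) ^ 2 * 4 * ((lap μ (-(θ * Complex.I))).re ^ 2)⁻¹ := by
    intro ε hε θ hθ
    have h0 : 0 < (lap μ (-(θ * Complex.I))).re := lt_of_le_of_ne (re_lap_nonneg θ) hθ.symm
    have h1 := (half_re_lap_le (μ := μ) hε.le θ).trans (Complex.re_le_norm _)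
    have h2 := norm_sum_exp_le n (s := (ε : ℂ) - θ * Complex.I) (by simpa using hε.le)
    calc _ ≤ (n : ℝ) ^ 2 / ((lap μ (-(θ * Complex.I))).re / 2) ^ 2 := by gcongr
      _ = _ := by
        field_simp
        norm_num
  have hint := (h.intervalIntegrable_inv_sq hα₀ hα (-Real.pi) Real.pi).const_mul ((n : ℝ) ^ 2 * 4)
  have hlim : Tendsto (fun ε : ℝ => ∫ θ in (-Real.pi)..Real.pi,
        ‖∑ j ∈ Finset.range n, Complex.exp (-((ε : ℂ) - θ * Complex.I) * j)‖ ^ 2 /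
          ‖lap μ (ε - θ * Complex.I)‖ ^ 2) (𝓝[>] 0)
      (𝓝 (∫ θ in (-Real.pi)..Real.pi,
        ‖∑ j ∈ Finset.range n, Complex.exp (θ * Complex.I * j)‖ ^ 2 /
          ‖lap μ (-(θ * Complex.I))‖ ^ 2)) := by
    refine intervalIntegral.tendsto_integral_filter_of_dominated_convergence _ ?_ ?_ hint ?_
    · filter_upwards [self_mem_nhdsWithin] with ε hε
      have hε0 : 0 < ε := hε
      have hc : Continuous fun θ : ℝ => lap μ (ε - θ * Complex.I) :=
        continuous_lap_of_nonneg (by fun_prop) (by simpa using hε0.le)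
      have hm := hc.norm.measurable
      refine Measurable.aestronglyMeasurable ?_
      exact Measurable.div (Continuous.measurable (by fun_prop)) (hm.pow_const 2)
    · filter_upwards [self_mem_nhdsWithin] with ε hε
      filter_upwards [hne] with θ hθ _
      rw [Real.norm_of_nonneg (by positivity)]
      exact hbound ε hε θ hθ
    · filter_upwards [hne] with θ hθ _
      have hθ' : lap μ (-(θ * Complex.I)) ≠ 0 := fun h0 => hθ (by rw [h0, Complex.zero_re])
      have hc : Continuous fun ε : ℝ => lap μ ((|ε| : ℝ) - θ * Complex.I) :=
        continuous_lap_of_nonneg (by fun_prop) (by simp)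
      have h1 : Tendsto (fun ε : ℝ => lap μ (ε - θ * Complex.I)) (𝓝[>] 0)
          (𝓝 (lap μ (-(θ * Complex.I)))) := by
        have h2 := (hc.tendsto 0).mono_left (nhdsWithin_le_nhds (s := Set.Ioi 0))
        simp only [abs_zero, Complex.ofReal_zero, zero_sub] at h2
        refine h2.congr' ?_
        filter_upwards [self_mem_nhdsWithin] with ε hε
        rw [abs_of_pos hε]
      have h3 : Tendsto (fun ε : ℝ => ∑ j ∈ Finset.range n,
          Complex.exp (-((ε : ℂ) - θ * Complex.I) * j)) (𝓝[>] 0)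
          (𝓝 (∑ j ∈ Finset.range n, Complex.exp (θ * Complex.I * j))) := by
        have : Continuous fun ε : ℝ => ∑ j ∈ Finset.range n,
            Complex.exp (-((ε : ℂ) - θ * Complex.I) * j) := by fun_prop
        have h2 := (this.tendsto 0).mono_left (nhdsWithin_le_nhds (s := Set.Ioi 0))
        simpa using h2
      exact (h3.norm.pow 2).div (h1.norm.pow 2) (by simpa using hθ')
  have hlim' := hlim.const_mul (2 * Real.pi)⁻¹
  generalize (2 * Real.pi)⁻¹ * ∫ θ in (-Real.pi)..Real.pi,
        ‖∑ j ∈ Finset.range n, Complex.exp (θ * Complex.I * j)‖ ^ 2 /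
          ‖lap μ (-(θ * Complex.I))‖ ^ 2 = R at hlim' ⊢
  have hexp : ∀ t : ℕ, Tendsto (fun ε : ℝ => (block μ n t * Real.exp (-ε * t)) ^ 2) (𝓝[>] 0)
      (𝓝 (block μ n t ^ 2)) := by
    intro t
    have : Continuous fun ε : ℝ => (block μ n t * Real.exp (-ε * t)) ^ 2 := by fun_prop
    have h2 := (this.tendsto 0).mono_left (nhdsWithin_le_nhds (s := Set.Ioi 0))
    simpa using h2
  have hle : ∀ ε : ℝ, 0 < ε → ∀ t : ℕ, (block μ n t * Real.exp (-ε * t)) ^ 2 ≤ block μ n t ^ 2 := by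
    intro ε hε t
    have h1 : Real.exp (-ε * t) ≤ 1 := Real.exp_le_one_iff.2 (by
      have : 0 ≤ ε * t := by positivity
      linarith)
    have h2 := block_nonneg μ n t
    have h3 := Real.exp_pos (-ε * t)
    gcongr
    nlinarith
  have hdamped : ∀ ε : ℝ, 0 < ε → Summable fun t : ℕ => (block μ n t * Real.exp (-ε * t)) ^ 2 := by
    intro ε hε
    have hg : Summable fun t : ℕ => (n : ℝ) ^ 2 * Real.exp (-ε) ^ t :=
      (summable_geometric_of_lt_one (Real.exp_pos _).le (by simpa using hε)).mul_left _
    refine hg.of_nonneg_of_le (fun _ => sq_nonneg _) fun t => ?_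
    have h1 : Real.exp (-ε * t) = Real.exp (-ε) ^ t := by
      rw [← Real.exp_nat_mul]
      congr 1
      ring
    have h2 : Real.exp (-ε) ^ t ≤ 1 :=
      pow_le_one₀ (Real.exp_pos _).le (Real.exp_le_one_iff.2 (by linarith))
    have h3 := pow_pos (Real.exp_pos (-ε)) t
    have h4 := abs_block_le μ n t
    rw [h1, mul_pow, ← sq_abs (block μ n t)]
    gcongr
    nlinarith
  -- Fatou-type step: each finite sum is the limit of damped finite sums, bounded by full damped
  -- sums that tend to `R`. The undamped series then dominates the damped ones and identifies the
  -- sum as `R`.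
  have hfin : Summable fun t : ℕ => block μ n t ^ 2 := by
    refine summable_of_sum_le (c := R) (fun t => sq_nonneg _) fun u => ?_
    refine le_of_tendsto_of_tendsto (tendsto_finsetSum u fun t _ => hexp t) hlim' ?_
    filter_upwards [self_mem_nhdsWithin] with ε hε
    rw [← tsum_block_sq_damped hμ₀ n hε]
    exact (hdamped ε hε).sum_le_tsum u fun t _ => sq_nonneg _
  have hts : Tendsto (fun ε : ℝ => ∑' t : ℕ, (block μ n t * Real.exp (-ε * t)) ^ 2) (𝓝[>] 0)
      (𝓝 (∑' t : ℕ, block μ n t ^ 2)) := by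
    refine tendsto_tsum_of_dominated_convergence hfin hexp ?_
    filter_upwards [self_mem_nhdsWithin] with ε hε t
    rw [Real.norm_of_nonneg (sq_nonneg _)]
    exact hle ε hε t
  have heq : ∑' t : ℕ, block μ n t ^ 2 = R := by
    refine tendsto_nhds_unique hts (hlim'.congr' ?_)
    filter_upwards [self_mem_nhdsWithin] with ε hε
    exact (tsum_block_sq_damped hμ₀ n hε).symm
  rw [← heq]
  exact hfin.hasSum

lemma RegTail.summable_q_sq (h : RegTail α μ) (hα₀ : 0 < α) (hα : α < 1 / 2) (hμ₀ : μ {0} = 0) :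
    Summable fun t : ℕ => q μ t ^ 2 := by
  simpa only [block_one] using (h.hasSum_block_sq hα₀ hα hμ₀ 1).summable

end spectral

/-! ### Correlations of the renewal sequence -/

section corr

variable {μ : Measure ℕ} [IsProbabilityMeasure μ]

lemma summable_qCorr (hs : Summable fun t : ℕ => q μ t ^ 2) (i : ℕ) :
    Summable fun j : ℕ => q μ j * q μ (i + j) := by
  have h1 : Summable fun j : ℕ => q μ (i + j) ^ 2 :=
    hs.comp_injective (add_right_injective i)
  refine (hs.add h1).of_nonneg_of_le (fun j => mul_nonneg (q_nonneg μ _) (q_nonneg μ _)) fun j => ?_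
  nlinarith [sq_nonneg (q μ j - q μ (i + j)), sq_nonneg (q μ j), sq_nonneg (q μ (i + j))]

lemma hasSum_delayed_mul_of_le (hs : Summable fun t : ℕ => q μ t ^ 2) {i j : ℕ} (hij : i ≤ j) :
    HasSum (fun t => delayed μ i t * delayed μ j t) (qCorr μ (j - i)) := by
  rw [← (add_left_injective j).hasSum_iff]
  · refine (summable_qCorr hs (j - i)).hasSum.congr_fun fun t => ?_
    have h1 : i ≤ t + j := by omega
    have h2 : t + j - i = j - i + t := by omega
    simp [delayed, h1, h2, mul_comm]
  · intro t ht
    have : ¬ j ≤ t := fun h => ht ⟨t - j, Nat.sub_add_cancel h⟩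
    simp [delayed, this]

lemma hasSum_delayed_mul (hs : Summable fun t : ℕ => q μ t ^ 2) (i j : ℕ) :
    HasSum (fun t => delayed μ i t * delayed μ j t) (qCorr μ ((i : ℤ) - (j : ℤ)).natAbs) := by
  rcases le_total i j with h | h
  · have : ((i : ℤ) - (j : ℤ)).natAbs = j - i := by omega
    rw [this]
    exact hasSum_delayed_mul_of_le hs h
  · have : ((i : ℤ) - (j : ℤ)).natAbs = i - j := by omega
    rw [this]
    exact (hasSum_delayed_mul_of_le hs h).congr_fun fun t => mul_comm _ _

lemma sum_Icc_one_eq_sum_range (f : ℕ → ℝ) (n : ℕ) :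
    ∑ i ∈ Finset.Icc 1 n, f i = ∑ i ∈ Finset.range n, f (i + 1) := by
  rw [Finset.range_eq_Ico, Finset.sum_Ico_add' f 0 n 1]
  rfl

/-- Expanding the square links the double sum in the variance formula to the quantity computed
spectrally. -/
lemma hasSum_block_sq_qCorr (hs : Summable fun t : ℕ => q μ t ^ 2) (n : ℕ) :
    HasSum (fun t => block μ n t ^ 2)
      (∑ i ∈ Finset.Icc 1 n, ∑ j ∈ Finset.Icc 1 n, qCorr μ ((i : ℤ) - (j : ℤ)).natAbs) := by
  have h1 : HasSum (fun t => ∑ i ∈ Finset.range n, ∑ j ∈ Finset.range n,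
      delayed μ i t * delayed μ j t)
      (∑ i ∈ Finset.range n, ∑ j ∈ Finset.range n, qCorr μ ((i : ℤ) - (j : ℤ)).natAbs) :=
    hasSum_sum fun i _ => hasSum_sum fun j _ => hasSum_delayed_mul hs i j
  have h2 : ∑ i ∈ Finset.Icc 1 n, ∑ j ∈ Finset.Icc 1 n, qCorr μ ((i : ℤ) - (j : ℤ)).natAbs =
      ∑ i ∈ Finset.range n, ∑ j ∈ Finset.range n, qCorr μ ((i : ℤ) - (j : ℤ)).natAbs := by
    rw [sum_Icc_one_eq_sum_range]
    refine Finset.sum_congr rfl fun i _ => ?_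
    rw [sum_Icc_one_eq_sum_range]
    refine Finset.sum_congr rfl fun j _ => ?_
    push_cast
    congr 2
    ring
  rw [h2]
  refine h1.congr_fun fun t => ?_
  rw [block, sq, Finset.sum_mul_sum]

lemma one_le_qCorr_zero (hs : Summable fun t : ℕ => q μ t ^ 2) : 1 ≤ qCorr μ 0 := by
  have := (summable_qCorr hs 0).le_tsum 0
    fun j _ => mul_nonneg (q_nonneg μ j) (q_nonneg μ (0 + j))
  simpa [q_zero, qCorr] using this

end corr

/-! ### Evaluation of the limiting trigonometric integral -/

/-- Tonelli's theorem for Bochner integrals of a nonnegative function whose slices are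
integrable. -/
lemma integral_integral_swap_of_nonneg {f : ℝ → ℝ → ℝ} (hm : Measurable (Function.uncurry f))
    (h0 : ∀ x y, 0 < x → 0 < y → 0 ≤ f x y)
    (h1 : ∀ x, 0 < x → IntegrableOn (fun y => f x y) (Set.Ioi 0))
    (h2 : ∀ y, 0 < y → IntegrableOn (fun x => f x y) (Set.Ioi 0)) :
    ∫ x in Set.Ioi (0 : ℝ), ∫ y in Set.Ioi (0 : ℝ), f x y =
      ∫ y in Set.Ioi (0 : ℝ), ∫ x in Set.Ioi (0 : ℝ), f x y := by
  have hmem : ∀ᵐ x ∂(volume.restrict (Set.Ioi (0 : ℝ))), 0 < x := ae_restrict_mem measurableSet_Ioi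
  have e1 : ∀ x, 0 < x → ∫ y in Set.Ioi (0 : ℝ), f x y =
      (∫⁻ y in Set.Ioi (0 : ℝ), ENNReal.ofReal (f x y)).toReal := fun x hx =>
    integral_eq_lintegral_of_nonneg_ae (hmem.mono fun y hy => h0 x y hx hy)
      (h1 x hx).aestronglyMeasurable
  have e2 : ∀ y, 0 < y → ∫ x in Set.Ioi (0 : ℝ), f x y =
      (∫⁻ x in Set.Ioi (0 : ℝ), ENNReal.ofReal (f x y)).toReal := fun y hy =>
    integral_eq_lintegral_of_nonneg_ae (hmem.mono fun x hx => h0 x y hx hy)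
      (h2 y hy).aestronglyMeasurable
  have t1 : ∀ x, 0 < x → ∫⁻ y in Set.Ioi (0 : ℝ), ENNReal.ofReal (f x y) ≠ ⊤ := fun x hx =>
    (h1 x hx).lintegral_lt_top.ne
  have t2 : ∀ y, 0 < y → ∫⁻ x in Set.Ioi (0 : ℝ), ENNReal.ofReal (f x y) ≠ ⊤ := fun y hy =>
    (h2 y hy).lintegral_lt_top.ne
  have hm' : Measurable (Function.uncurry fun x y => ENNReal.ofReal (f x y)) := hm.ennreal_ofReal
  rw [setIntegral_congr_fun measurableSet_Ioi e1, setIntegral_congr_fun measurableSet_Ioi e2,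
    integral_toReal (f := fun x => ∫⁻ y in Set.Ioi (0 : ℝ), ENNReal.ofReal (f x y))
      (Measurable.lintegral_prod_right' hm').aemeasurable (hmem.mono fun x hx => (t1 x hx).lt_top),
    integral_toReal (f := fun y => ∫⁻ x in Set.Ioi (0 : ℝ), ENNReal.ofReal (f x y))
      (Measurable.lintegral_prod_left' hm').aemeasurable (hmem.mono fun y hy => (t2 y hy).lt_top),
    lintegral_lintegral_swap hm'.aemeasurable]

lemma integral_exp_mul_one_sub_cos {y : ℝ} (hy : 0 < y) :
    IntegrableOn (fun x : ℝ => (1 - Real.cos x) * Real.exp (-(x * y))) (Set.Ioi 0) ∧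
    ∫ x in Set.Ioi (0 : ℝ), (1 - Real.cos x) * Real.exp (-(x * y)) = 1 / (y * (1 + y ^ 2)) := by
  have i1 : IntegrableOn (fun x : ℝ => Complex.exp ((-(y : ℂ)) * x)) (Set.Ioi 0) :=
    integrableOn_exp_mul_complex_Ioi (by simpa using hy) 0
  have hre : (-(y : ℂ) + Complex.I).re < 0 := by simpa using hy
  have i2 : IntegrableOn (fun x : ℝ => Complex.exp ((-(y : ℂ) + Complex.I) * x)) (Set.Ioi 0) :=
    integrableOn_exp_mul_complex_Ioi hre 0
  have hf : ∀ x : ℝ, (1 - Real.cos x) * Real.exp (-(x * y)) =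
      RCLike.re (Complex.exp ((-(y : ℂ)) * x) - Complex.exp ((-(y : ℂ) + Complex.I) * x)) := by
    intro x
    simp [Complex.exp_re, mul_comm x y]
    ring
  have hI := i1.sub i2
  constructor
  · refine hI.re.congr (ae_of_all _ fun x => ?_)
    exact (hf x).symm
  · simp_rw [hf]
    have hre2 := integral_re hI
    simp only [Pi.sub_apply] at hre2
    rw [hre2, integral_sub i1 i2, integral_exp_mul_complex_Ioi (by simpa using hy),
      integral_exp_mul_complex_Ioi hre]
    have hn : Complex.normSq (-(y : ℂ) + Complex.I) = 1 + y ^ 2 := by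
      simp [Complex.normSq_apply]
      ring
    have hy0 : (y : ℂ) ≠ 0 := by exact_mod_cast hy.ne'
    simp [Complex.div_re, hn]
    have : Complex.normSq (y : ℂ) = y ^ 2 := by simp [Complex.normSq_apply, sq]
    field_simp
    ring

/-- `1 / (1 + y²) = ∫ exp (-(1 + y²) u) du`; after exchanging the integrals, two Gamma integrals
give `Γ((1 + b)/2) Γ((1 - b)/2) / 2`, evaluated by the reflection formula. -/
lemma integral_rpow_div_one_add_sq {b : ℝ} (hb0 : 0 < b) (hb1 : b < 1) :
    ∫ y in Set.Ioi (0 : ℝ), y ^ b / (1 + y ^ 2) = Real.pi / (2 * Real.cos (Real.pi * b / 2)) := by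
  let f : ℝ → ℝ → ℝ := fun y u => y ^ b * Real.exp (-((1 + y ^ 2) * u))
  have g1 : ∀ y : ℝ, IntegrableOn (fun u => f y u) (Set.Ioi 0) ∧
      ∫ u in Set.Ioi (0 : ℝ), f y u = y ^ b / (1 + y ^ 2) := by
    intro y
    have hp : 0 < 1 + y ^ 2 := by positivity
    have h1 : IntegrableOn (fun u : ℝ => Real.exp (-((1 + y ^ 2)) * u)) (Set.Ioi 0) :=
      exp_neg_integrableOn_Ioi 0 hp
    have h2 := integral_exp_mul_Ioi (a := -(1 + y ^ 2)) (by linarith) 0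
    simp only [f, ← neg_mul]
    refine ⟨h1.const_mul _, ?_⟩
    rw [integral_const_mul, h2, mul_zero, Real.exp_zero, neg_div_neg_eq, mul_one_div]
  have g2 : ∀ u : ℝ, 0 < u → IntegrableOn (fun y => f y u) (Set.Ioi 0) ∧
      ∫ y in Set.Ioi (0 : ℝ), f y u =
        (1 / 2 * Real.Gamma ((b + 1) / 2)) * (u ^ ((1 - b) / 2 - 1) * Real.exp (-(1 * u))) := by
    intro u hu
    have h1 := integrableOn_rpow_mul_exp_neg_mul_rpow (s := b) (p := 2) (b := u) (by linarith)
      two_pos hu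
    have h2 := integral_rpow_mul_exp_neg_mul_rpow (p := 2) (q := b) (b := u) two_pos
      (by linarith) hu
    have hf : ∀ y : ℝ, f y u = Real.exp (-u) * (y ^ b * Real.exp (-u * y ^ (2 : ℝ))) := by
      intro y
      simp only [f, Real.rpow_two]
      rw [mul_left_comm, ← Real.exp_add]
      congr 2
      ring
    simp_rw [hf]
    refine ⟨h1.const_mul _, ?_⟩
    rw [integral_const_mul, h2]
    have : -(b + 1) / 2 = (1 - b) / 2 - 1 := by ring
    rw [this]
    ring_nf
  have hswap := integral_integral_swap_of_nonneg (f := f)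
    (by unfold Function.uncurry; fun_prop)
    (fun x y hx _ => by positivity) (fun x _ => (g1 x).1) (fun y hy => (g2 y hy).1)
  rw [setIntegral_congr_fun measurableSet_Ioi fun y _ => (g1 y).2,
    setIntegral_congr_fun measurableSet_Ioi fun u hu => (g2 u hu).2, integral_const_mul,
    Real.integral_rpow_mul_exp_neg_mul_Ioi (by linarith) one_pos] at hswap
  have href := Real.Gamma_mul_Gamma_one_sub ((b + 1) / 2)
  have h3 : 1 - (b + 1) / 2 = (1 - b) / 2 := by ring
  have h4 : Real.pi * ((b + 1) / 2) = Real.pi * b / 2 + Real.pi / 2 := by ring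
  rw [h3, h4, Real.sin_add_pi_div_two] at href
  rw [hswap]
  simp only [div_one, Real.one_rpow, one_mul]
  rw [mul_assoc, href, div_mul_div_comm, one_mul]

/-- `Γ(2 + b) x ^ (-(2 + b))` is the Laplace transform of `y ^ (1 + b)`; exchanging the integrals
reduces to `integral_rpow_div_one_add_sq`. It is used with `b = 2α`. -/
lemma integral_one_sub_cos_mul_rpow {b : ℝ} (hb0 : 0 < b) (hb1 : b < 1) :
    ∫ x in Set.Ioi (0 : ℝ), (1 - Real.cos x) * x ^ (-(2 + b)) =
      Real.pi / (2 * Real.Gamma (2 + b) * Real.cos (Real.pi * b / 2)) := by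
  let f : ℝ → ℝ → ℝ := fun x y => (1 - Real.cos x) * (y ^ (1 + b) * Real.exp (-(x * y)))
  have hG : 0 < Real.Gamma (2 + b) := Real.Gamma_pos_of_pos (by linarith)
  have g1 : ∀ x : ℝ, 0 < x → IntegrableOn (fun y => f x y) (Set.Ioi 0) ∧
      ∫ y in Set.Ioi (0 : ℝ), f x y = Real.Gamma (2 + b) * ((1 - Real.cos x) * x ^ (-(2 + b))) := by
    intro x hx
    have h1 := integrableOn_rpow_mul_exp_neg_mul_rpow (s := 1 + b) (p := 1) (b := x) (by linarith)
      one_pos hx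
    have h2 := Real.integral_rpow_mul_exp_neg_mul_Ioi (a := 2 + b) (r := x) (by linarith) hx
    have h3 : 2 + b - 1 = 1 + b := by ring
    rw [h3] at h2
    simp only [Real.rpow_one] at h1
    refine ⟨?_, ?_⟩
    · simp only [f, ← neg_mul]
      exact h1.const_mul _
    · simp only [f]
      rw [integral_const_mul, h2, one_div, Real.inv_rpow hx.le, ← Real.rpow_neg hx.le]
      ring
  have g2 : ∀ y : ℝ, 0 < y → IntegrableOn (fun x => f x y) (Set.Ioi 0) ∧
      ∫ x in Set.Ioi (0 : ℝ), f x y = y ^ b / (1 + y ^ 2) := by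
    intro y hy
    obtain ⟨h1, h2⟩ := integral_exp_mul_one_sub_cos hy
    have hf : ∀ x, f x y = y ^ (1 + b) * ((1 - Real.cos x) * Real.exp (-(x * y))) := by
      intro x
      simp only [f]
      ring
    simp_rw [hf]
    refine ⟨h1.const_mul _, ?_⟩
    rw [integral_const_mul, h2, Real.rpow_add hy, Real.rpow_one]
    field_simp
  have hswap := integral_integral_swap_of_nonneg (f := f)
    (by unfold Function.uncurry; fun_prop)
    (fun x y _ hy => mul_nonneg (sub_nonneg.2 (Real.cos_le_one x)) (by positivity))
    (fun x hx => (g1 x hx).1) (fun y hy => (g2 y hy).1)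
  rw [setIntegral_congr_fun measurableSet_Ioi fun x hx => (g1 x hx).2,
    setIntegral_congr_fun measurableSet_Ioi fun y hy => (g2 y hy).2, integral_const_mul,
    integral_rpow_div_one_add_sq hb0 hb1] at hswap
  rw [← mul_right_inj' hG.ne', hswap]
  have hc : 0 < Real.cos (Real.pi * b / 2) := by
    have := Real.pi_pos
    apply Real.cos_pos_of_mem_Ioo
    constructor <;> nlinarith
  field_simp

/-! ### The Dirichlet kernel and the asymptotics of the spectral integral -/

/-- The modulus of the Dirichlet kernel. -/
def dirichlet (n : ℕ) (θ : ℝ) : ℝ := ‖∑ j ∈ Finset.range n, Complex.exp (θ * Complex.I * j)‖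

lemma dirichlet_nonneg (n : ℕ) (θ : ℝ) : 0 ≤ dirichlet n θ := norm_nonneg _

lemma continuous_dirichlet (n : ℕ) : Continuous (dirichlet n) := by
  unfold dirichlet
  fun_prop

lemma dirichlet_le (n : ℕ) (θ : ℝ) : dirichlet n θ ≤ n := by
  have := norm_sum_exp_le n (s := -(θ * Complex.I)) (by simp)
  simpa [dirichlet] using this

/-- Geometric sum, with `|exp (ix) - 1| = 2 |sin (x / 2)|`. The product form avoids dividing by a
sine that may vanish. -/
lemma dirichlet_mul_abs_sin (n : ℕ) (θ : ℝ) :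
    dirichlet n θ * |Real.sin (θ / 2)| = |Real.sin (n * θ / 2)| := by
  have h1 := geom_sum_mul (Complex.exp (Complex.I * θ)) n
  have h2 : ∀ j : ℕ, Complex.exp (Complex.I * θ) ^ j = Complex.exp (θ * Complex.I * j) := by
    intro j
    rw [← Complex.exp_nat_mul]
    congr 1
    ring
  have h3 : Complex.exp (θ * Complex.I * n) = Complex.exp (Complex.I * ((n * θ : ℝ) : ℂ)) := by
    congr 1
    push_cast
    ring
  simp_rw [h2] at h1
  have h4 := congrArg norm h1
  rw [norm_mul, h3, Complex.norm_exp_I_mul_ofReal_sub_one, Complex.norm_exp_I_mul_ofReal_sub_one,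
    norm_mul, norm_mul, Real.norm_eq_abs, Real.norm_eq_abs, Real.norm_eq_abs] at h4
  norm_num at h4
  unfold dirichlet
  linarith

lemma dirichlet_mul_abs_le (n : ℕ) {θ : ℝ} (hθ : |θ| ≤ Real.pi) :
    dirichlet n θ * |θ| ≤ Real.pi := by
  have hpi := Real.pi_pos
  have h1 : 2 / Real.pi * |θ / 2| ≤ |Real.sin (θ / 2)| :=
    Real.mul_abs_le_abs_sin (by
      rw [abs_div, abs_two]
      linarith)
  have h2 := dirichlet_mul_abs_sin n θ
  have h3 := Real.abs_sin_le_one (n * θ / 2)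
  have h4 := mul_le_mul_of_nonneg_left h1 (dirichlet_nonneg n θ)
  rw [h2, abs_div, abs_two] at h4
  have h5 : dirichlet n θ * (2 / Real.pi * (|θ| / 2)) = dirichlet n θ * |θ| / Real.pi := by
    field_simp
  rw [h5, div_le_iff₀ hpi] at h4
  nlinarith

lemma tendsto_dirichlet_div {t : ℝ} (ht : t ≠ 0) :
    Tendsto (fun n : ℕ => dirichlet n (t / n) / n) atTop (𝓝 |2 * Real.sin (t / 2) / t|) := by
  have h1 : Tendsto (fun n : ℕ => (n : ℝ) * Real.sin (t / n / 2)) atTop (𝓝 (t / 2)) := by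
    have hz : Tendsto (fun n : ℕ => t / 2 / (n : ℝ)) atTop (𝓝 0) :=
      tendsto_const_div_atTop_nhds_zero_nat _
    have h2 := ((Real.continuous_sinc.tendsto 0).comp hz).const_mul (t / 2)
    rw [Real.sinc_zero, mul_one] at h2
    refine h2.congr' ?_
    filter_upwards [eventually_ge_atTop 1] with n hn
    have hn0 : (n : ℝ) ≠ 0 := by positivity
    have hne : t / 2 / (n : ℝ) ≠ 0 := by positivity
    have e : t / (n : ℝ) / 2 = t / 2 / n := by ring
    simp only [Function.comp]
    rw [Real.sinc_of_ne_zero hne, e]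
    field_simp
  have ht2 : t / 2 ≠ 0 := by positivity
  have h3 : Tendsto (fun n : ℕ => |Real.sin (t / 2)| / |(n : ℝ) * Real.sin (t / n / 2)|) atTop
      (𝓝 (|Real.sin (t / 2)| / |t / 2|)) :=
    tendsto_const_nhds.div h1.abs (abs_ne_zero.2 ht2)
  have h4 : |Real.sin (t / 2)| / |t / 2| = |2 * Real.sin (t / 2) / t| := by
    rw [← abs_div]
    congr 1
    field_simp
  rw [h4] at h3
  refine h3.congr' ?_
  filter_upwards [eventually_ge_atTop 1, h1.eventually_ne ht2] with n hn hne
  have hn0 : (n : ℝ) ≠ 0 := by positivity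
  have h5 := dirichlet_mul_abs_sin n (t / n)
  have h6 : (n : ℝ) * (t / n) / 2 = t / 2 := by field_simp
  rw [h6] at h5
  have h7 : |Real.sin (t / n / 2)| ≠ 0 := abs_ne_zero.2 (right_ne_zero_of_mul hne)
  rw [← h5, abs_mul, Nat.abs_cast, mul_div_mul_right _ _ h7]

/-- The density of the spectral representation of the block sums. -/
def spec (μ : Measure ℕ) (n : ℕ) (θ : ℝ) : ℝ :=
  dirichlet n θ ^ 2 / ‖lap μ (-(θ * Complex.I))‖ ^ 2

section

variable {α : ℝ} {μ : Measure ℕ} [IsProbabilityMeasure μ]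

lemma spec_nonneg (n : ℕ) (θ : ℝ) : 0 ≤ spec μ n θ := by
  unfold spec
  positivity

lemma measurable_spec (n : ℕ) : Measurable (spec μ n) :=
  ((continuous_dirichlet n).measurable.pow_const 2).div
    (continuous_lap_imag.norm.measurable.pow_const 2)

lemma norm_lap_sq_inv_le {θ : ℝ} (hθ : (lap μ (-(θ * Complex.I))).re ≠ 0) :
    (‖lap μ (-(θ * Complex.I))‖ ^ 2)⁻¹ ≤ ((lap μ (-(θ * Complex.I))).re ^ 2)⁻¹ := by
  have h0 : 0 < (lap μ (-(θ * Complex.I))).re := lt_of_le_of_ne (re_lap_nonneg θ) hθ.symm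
  have := Complex.re_le_norm (lap μ (-(θ * Complex.I)))
  gcongr

namespace RegTail

lemma ae_re_lap_ne_zero (h : RegTail α μ) (hα₀ : 0 < α) :
    ∀ᵐ θ : ℝ, (lap μ (-(θ * Complex.I))).re ≠ 0 := by
  rw [ae_iff]
  simpa using h.re_lap_zeros_null hα₀

lemma intervalIntegrable_spec (h : RegTail α μ) (hα₀ : 0 < α) (hα : α < 1 / 2) (n : ℕ) (a b : ℝ) :
    IntervalIntegrable (spec μ n) volume a b := by
  refine ((h.intervalIntegrable_inv_sq hα₀ hα a b).const_mul ((n : ℝ) ^ 2)).mono_fun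
    (measurable_spec n).aestronglyMeasurable (ae_restrict_of_ae ?_)
  filter_upwards [h.ae_re_lap_ne_zero hα₀] with θ hθ
  rw [Real.norm_of_nonneg (spec_nonneg n θ), Real.norm_of_nonneg (by positivity), spec,
    div_eq_mul_inv]
  have := norm_lap_sq_inv_le hθ
  have := dirichlet_le n θ
  have := dirichlet_nonneg n θ
  gcongr

/-- Away from the origin the spectral density stays bounded in mean. -/
lemma integral_spec_far_le (h : RegTail α μ) (hα₀ : 0 < α) (hα : α < 1 / 2) {δ a b : ℝ}
    (hδ : 0 < δ) (hab : a ≤ b) (hd : ∀ θ ∈ Set.Icc a b, δ ≤ |θ| ∧ |θ| ≤ Real.pi) (n : ℕ) :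
    ∫ θ in a..b, spec μ n θ ≤
      ∫ θ in a..b, (Real.pi / δ) ^ 2 * ((lap μ (-(θ * Complex.I))).re ^ 2)⁻¹ := by
  refine intervalIntegral.integral_mono_ae_restrict hab (h.intervalIntegrable_spec hα₀ hα n a b)
    ((h.intervalIntegrable_inv_sq hα₀ hα a b).const_mul _) ?_
  filter_upwards [ae_restrict_of_ae (h.ae_re_lap_ne_zero hα₀), ae_restrict_mem measurableSet_Icc]
    with θ hθ hmem
  obtain ⟨h1, h2⟩ := hd θ hmem
  have h3 := dirichlet_mul_abs_le n h2
  have h4 : dirichlet n θ ≤ Real.pi / δ := by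
    rw [le_div_iff₀ hδ]
    exact (mul_le_mul_of_nonneg_left h1 (dirichlet_nonneg n θ)).trans h3
  rw [spec, div_eq_mul_inv]
  have := norm_lap_sq_inv_le hθ
  have := dirichlet_nonneg n θ
  gcongr

/-- Domination of the rescaled spectral density. -/
lemma exists_spec_bound (h : RegTail α μ) (hα₀ : 0 < α) {β : ℝ} (hβ : α < β) :
    ∃ C δ : ℝ, 0 < C ∧ 0 < δ ∧ δ ≤ Real.pi ∧ ∀ (n : ℕ) (t : ℝ), 1 ≤ n → t ≠ 0 → |t / n| ≤ δ →
      spec μ n (t / n) * (tail μ n / n) ^ 2 ≤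
        (Set.Icc (-1) 1).indicator (fun t => C * |t| ^ (-(2 * β))) t + C * (1 + t ^ 2)⁻¹ := by
  have hpi := Real.pi_pos
  obtain ⟨c, δ, hc, hδ, h1⟩ := h.exists_tail_le_re_lap hα₀
  obtain ⟨c₂, hc₂, h2⟩ := h.potter hβ (hα₀.trans hβ)
  -- The first constant serves `|t| ≤ 1` (kernel at most `n`, Potter for the exponent), the second
  -- `|t| > 1` (kernel at most `π n / |t|`, tail monotone); its factor 2 comes from `(1 + t²) / t² ≤
  -- 2`.
  refine ⟨max ((c * c₂) ^ 2)⁻¹ (2 * (Real.pi / c) ^ 2), min δ Real.pi, by positivity,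
    by positivity, min_le_right _ _, fun n t hn ht htn => ?_⟩
  set C := max ((c * c₂) ^ 2)⁻¹ (2 * (Real.pi / c) ^ 2)
  have hn0 : (0 : ℝ) < n := by exact_mod_cast hn
  have ht0 : 0 < |t| := abs_pos.2 ht
  have habs : |t / n| = |t| / n := by rw [abs_div, Nat.abs_cast]
  have htn0 : 0 < |t / n| := by rw [habs]; positivity
  have h3 := (h1 (t / n) htn0 (htn.trans (min_le_left _ _))).trans (Complex.re_le_norm _)
  have hinv : 1 / |t / n| = n / |t| := by rw [habs, one_div_div]
  rw [hinv] at h3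
  have hT := h.pos n
  have hT2 := h.pos (n / |t|)
  set ψ := ‖lap μ (-((t / n : ℝ) * Complex.I))‖ with hψ
  have hψ0 : 0 < ψ := lt_of_lt_of_le (by positivity) h3
  have hspec : spec μ n (t / n) * (tail μ n / n) ^ 2 =
      (dirichlet n (t / n) / n) ^ 2 * (tail μ n / ψ) ^ 2 := by
    rw [spec, ← hψ]
    field_simp
  rw [hspec]
  have hD0 := dirichlet_nonneg n (t / n)
  have hC1 : 0 ≤ C * (1 + t ^ 2)⁻¹ := by positivity
  by_cases h1t : |t| ≤ 1
  · rw [Set.indicator_of_mem (Set.mem_Icc.2 (abs_le.1 h1t))]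
    have e1 : dirichlet n (t / n) / n ≤ 1 := (div_le_one hn0).2 (dirichlet_le n _)
    have e2 : tail μ n / ψ ≤ (c * c₂)⁻¹ * |t| ^ (-β) := by
      have h4 := h2 n (1 / |t|) hn0.le ((one_le_div ht0).2 h1t)
      rw [one_div, Real.inv_rpow ht0.le, Real.rpow_neg ht0.le, inv_inv, inv_mul_eq_div] at h4
      have hb := Real.rpow_pos_of_pos ht0 β
      rw [div_le_iff₀ hψ0, Real.rpow_neg ht0.le]
      calc tail μ n = (c * c₂)⁻¹ * (|t| ^ β)⁻¹ * (c * (c₂ * |t| ^ β * tail μ n)) := by field_simp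
        _ ≤ (c * c₂)⁻¹ * (|t| ^ β)⁻¹ * (c * tail μ (n / |t|)) := by gcongr
        _ ≤ _ := by gcongr
    have e3 : (|t| ^ (-β)) ^ 2 = |t| ^ (-(2 * β)) := by
      rw [← Real.rpow_natCast, ← Real.rpow_mul ht0.le]
      congr 1
      push_cast
      ring
    calc (dirichlet n (t / n) / n) ^ 2 * (tail μ n / ψ) ^ 2
        ≤ 1 ^ 2 * ((c * c₂)⁻¹ * |t| ^ (-β)) ^ 2 := by gcongr
      _ = ((c * c₂) ^ 2)⁻¹ * |t| ^ (-(2 * β)) := by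
          rw [mul_pow, e3, inv_pow]
          ring
      _ ≤ C * |t| ^ (-(2 * β)) := by
          gcongr
          exact le_max_left _ _
      _ ≤ _ := le_add_of_nonneg_right hC1
  · have h1t' : 1 < |t| := not_le.1 h1t
    rw [Set.indicator_of_notMem (fun hm : t ∈ Set.Icc (-1 : ℝ) 1 => h1t (abs_le.2 hm)), zero_add]
    have e1 : dirichlet n (t / n) / n ≤ Real.pi / |t| := by
      have := dirichlet_mul_abs_le n (htn.trans (min_le_right _ _))
      rw [habs] at this
      rw [div_le_div_iff₀ hn0 ht0]
      calc dirichlet n (t / n) * |t| = dirichlet n (t / n) * (|t| / n) * n := by field_simp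
        _ ≤ Real.pi * n := by gcongr
    have e2 : tail μ n / ψ ≤ c⁻¹ := by
      rw [div_le_iff₀ hψ0]
      have : tail μ n ≤ tail μ (n / |t|) := by
        apply tail_antitone
        rw [div_le_iff₀ ht0]
        nlinarith
      calc tail μ n ≤ tail μ (n / |t|) := this
        _ = c⁻¹ * (c * tail μ (n / |t|)) := by field_simp
        _ ≤ _ := by gcongr
    have e3 : (1 + t ^ 2) / t ^ 2 ≤ 2 := by
      have : 1 < t ^ 2 := by
        rw [← sq_abs]
        nlinarith
      rw [div_le_iff₀ (by linarith)]
      linarith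
    calc (dirichlet n (t / n) / n) ^ 2 * (tail μ n / ψ) ^ 2
        ≤ (Real.pi / |t|) ^ 2 * c⁻¹ ^ 2 := by gcongr
      _ = (Real.pi / c) ^ 2 * ((1 + t ^ 2) / t ^ 2) * (1 + t ^ 2)⁻¹ := by
          rw [div_pow, sq_abs]
          field_simp
      _ ≤ (Real.pi / c) ^ 2 * 2 * (1 + t ^ 2)⁻¹ := by gcongr
      _ ≤ C * (1 + t ^ 2)⁻¹ := by
          gcongr
          rw [mul_comm]
          exact le_max_right _ _

lemma integrable_spec_bound {β : ℝ} (hβ : β < 1 / 2) (C : ℝ) :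
    Integrable fun t : ℝ =>
      (Set.Icc (-1) 1).indicator (fun t => C * |t| ^ (-(2 * β))) t + C * (1 + t ^ 2)⁻¹ := by
  refine Integrable.add ?_ (integrable_inv_one_add_sq.const_mul C)
  rw [integrable_indicator_iff measurableSet_Icc]
  have := (intervalIntegrable_abs_rpow (r := -(2 * β)) (by linarith) (-1) 1).1
  rw [← integrableOn_Icc_iff_integrableOn_Ioc] at this
  exact this.const_mul C

/-- The integrand is even and equals `2 (1 - cos t) |t| ^ (-(2 + 2α)) / Γ(1 - α)²`; `K α` appears
after writing `Γ(2 + 2α)` through `Γ(2α)`. -/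
lemma integral_spec_limit (hα₀ : 0 < α) (hα : α < 1 / 2) :
    ∫ t : ℝ, |2 * Real.sin (t / 2) / t| ^ 2 * ((Real.Gamma (1 - α) * |t| ^ α) ^ 2)⁻¹ =
      2 * Real.pi * K α := by
  have hG1 : 0 < Real.Gamma (1 - α) := Real.Gamma_pos_of_pos (by linarith)
  have hG2 : 0 < Real.Gamma (2 * α) := Real.Gamma_pos_of_pos (by linarith)
  have hpi := Real.pi_pos
  have hcos : 0 < Real.cos (Real.pi * α) := by
    apply Real.cos_pos_of_mem_Ioo
    constructor <;> nlinarith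
  let f : ℝ → ℝ := fun x => 2 * (Real.Gamma (1 - α) ^ 2)⁻¹ *
    ((1 - Real.cos x) * x ^ (-(2 + 2 * α)))
  have h1 : ∀ᵐ t : ℝ, |2 * Real.sin (t / 2) / t| ^ 2 *
      ((Real.Gamma (1 - α) * |t| ^ α) ^ 2)⁻¹ = f |t| := by
    filter_upwards [Measure.ae_ne volume (0 : ℝ)] with t ht
    have ht0 : 0 < |t| := abs_pos.2 ht
    have e1 : 1 - Real.cos |t| = 2 * Real.sin (t / 2) ^ 2 := by
      rw [Real.cos_abs]
      have := Real.cos_sq' (t / 2)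
      have h2 := Real.cos_two_mul (t / 2)
      rw [mul_div_cancel₀ t two_ne_zero] at h2
      linarith
    have e2 : |t| ^ (-(2 + 2 * α)) = (|t| ^ 2 * (|t| ^ α) ^ 2)⁻¹ := by
      rw [Real.rpow_neg ht0.le, Real.rpow_add ht0, Real.rpow_two, mul_comm 2 α,
        Real.rpow_mul ht0.le, Real.rpow_two]
    simp only [f]
    rw [e1, e2, abs_div, abs_mul, abs_two, div_pow, mul_pow, sq_abs (Real.sin _)]
    field_simp
  rw [integral_congr_ae h1, integral_comp_abs, integral_const_mul,
    integral_one_sub_cos_mul_rpow (by linarith) (by linarith)]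
  have e3 : Real.Gamma (2 + 2 * α) = (2 * α + 1) * (2 * α * Real.Gamma (2 * α)) := by
    rw [← Real.Gamma_add_one (by positivity), ← Real.Gamma_add_one (by positivity)]
    congr 1
    ring
  have e4 : Real.pi * (2 * α) / 2 = Real.pi * α := by ring
  rw [e3, e4, K]
  field_simp

/-- The asymptotics of the sums of squares of the block sums. -/
lemma tendsto_integral_spec (h : RegTail α μ) (hα₀ : 0 < α) (hα : α < 1 / 2) :
    Tendsto (fun n : ℕ => (∫ θ in (-Real.pi)..Real.pi, spec μ n θ) * (tail μ n ^ 2 / n)) atTop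
      (𝓝 (2 * Real.pi * K α)) := by
  obtain ⟨β, hβ, hβ1⟩ := exists_between hα
  obtain ⟨C, δ, hC, hδ, hδpi, hbd⟩ := h.exists_spec_bound hα₀ hβ
  have hG1 : 0 < Real.Gamma (1 - α) := Real.Gamma_pos_of_pos (by linarith)
  -- Substituting `θ = t / n` spreads the factor `tail² / n` into `(tail / n)²` times `dt`, the
  -- normalisation for which the integrand converges under an integrable majorant.
  have hnear : Tendsto (fun n : ℕ => (∫ θ in (-δ)..δ, spec μ n θ) * (tail μ n ^ 2 / n)) atTop
      (𝓝 (2 * Real.pi * K α)) := by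
    rw [← integral_spec_limit hα₀ hα]
    have key : Tendsto (fun n : ℕ => ∫ t : ℝ, (Set.Ioc (-(δ * n)) (δ * n)).indicator
        (fun t => spec μ n (t / n) * (tail μ n / n) ^ 2) t) atTop
        (𝓝 (∫ t : ℝ, |2 * Real.sin (t / 2) / t| ^ 2 *
          ((Real.Gamma (1 - α) * |t| ^ α) ^ 2)⁻¹)) := by
      refine tendsto_integral_filter_of_dominated_convergence _ (Eventually.of_forall fun n => ?_)
        ?_ (integrable_spec_bound hβ1 C) ?_
      · refine Measurable.aestronglyMeasurable (Measurable.indicator ?_ measurableSet_Ioc)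
        exact ((measurable_spec n).comp (measurable_id.div_const _)).mul_const _
      · filter_upwards [eventually_ge_atTop 1] with n hn
        filter_upwards [Measure.ae_ne volume (0 : ℝ)] with t ht
        have hn0 : (0 : ℝ) < n := by exact_mod_cast hn
        have hB0 : 0 ≤ (Set.Icc (-1) 1).indicator (fun t => C * |t| ^ (-(2 * β))) t +
            C * (1 + t ^ 2)⁻¹ :=
          add_nonneg (Set.indicator_nonneg (fun _ _ => by positivity) _) (by positivity)
        by_cases hm : t ∈ Set.Ioc (-(δ * n)) (δ * n)
        · rw [Set.indicator_of_mem hm, Real.norm_of_nonneg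
            (mul_nonneg (spec_nonneg _ _) (sq_nonneg _))]
          refine hbd n t hn ht ?_
          rw [abs_div, Nat.abs_cast, div_le_iff₀ hn0, abs_le]
          exact ⟨hm.1.le, hm.2⟩
        · rw [Set.indicator_of_notMem hm, norm_zero]
          exact hB0
      · filter_upwards [Measure.ae_ne volume (0 : ℝ)] with t ht
        have ht0 : 0 < |t| := abs_pos.2 ht
        have hψ := h.tendsto_norm_lap_imag hα₀ (by linarith) t
        have hD := tendsto_dirichlet_div ht
        have hne : (Real.Gamma (1 - α) * |t| ^ α) ^ 2 ≠ 0 := by positivity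
        refine ((hD.pow 2).mul ((hψ.pow 2).inv₀ hne)).congr' ?_
        have hlarge : ∀ᶠ n : ℕ in atTop, |t| < δ * n :=
          (tendsto_natCast_atTop_atTop.const_mul_atTop hδ).eventually_gt_atTop _
        filter_upwards [hlarge, eventually_ge_atTop 1] with n hn hn1
        have hn0 : (n : ℝ) ≠ 0 := by positivity
        have hT := (h.pos n).ne'
        rw [Set.indicator_of_mem (Set.mem_Ioc.2 ⟨(abs_lt.1 hn).1, (abs_lt.1 hn).2.le⟩), spec]
        rw [div_pow, div_pow, inv_div, div_pow]
        ring
    refine key.congr' ?_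
    filter_upwards [eventually_ge_atTop 1] with n hn
    have hn0 : (0 : ℝ) < n := by exact_mod_cast hn
    rw [integral_indicator measurableSet_Ioc, ← intervalIntegral.integral_of_le
      (by nlinarith), intervalIntegral.integral_mul_const,
      intervalIntegral.integral_comp_div (fun x => spec μ n x) hn0.ne', smul_eq_mul]
    have e1 : -(δ * n) / (n : ℝ) = -δ := by field_simp
    have e2 : δ * n / (n : ℝ) = δ := by field_simp
    rw [e1, e2]
    field_simp
  -- Away from 0 the spectral integral is bounded in `n`, and `tail² / n ≤ 1 / n`.
  have hfar : ∀ a b : ℝ, a ≤ b → (∀ θ ∈ Set.Icc a b, δ ≤ |θ| ∧ |θ| ≤ Real.pi) →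
      Tendsto (fun n : ℕ => (∫ θ in a..b, spec μ n θ) * (tail μ n ^ 2 / n)) atTop (𝓝 0) := by
    intro a b hab hd
    set A := ∫ θ in a..b, (Real.pi / δ) ^ 2 * ((lap μ (-(θ * Complex.I))).re ^ 2)⁻¹
    refine squeeze_zero (fun n => ?_) (fun n => ?_) (tendsto_const_div_atTop_nhds_zero_nat A)
    · exact mul_nonneg (intervalIntegral.integral_nonneg hab fun θ _ => spec_nonneg n θ)
        (by positivity)
    · have h1 := h.integral_spec_far_le hα₀ hα hδ hab hd n
      have h0 : 0 ≤ ∫ θ in a..b, spec μ n θ :=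
        intervalIntegral.integral_nonneg hab fun θ _ => spec_nonneg n θ
      have h2 : tail μ n ^ 2 ≤ 1 := pow_le_one₀ (tail_nonneg μ n) (tail_le_one μ n)
      have hA := h0.trans h1
      calc (∫ θ in a..b, spec μ n θ) * (tail μ n ^ 2 / n) ≤ A * (1 / n) := by gcongr
        _ = A / n := by ring
  have h1 := hfar (-Real.pi) (-δ) (by linarith) fun θ hθ => by
    have : θ ≤ 0 := by linarith [hθ.2]
    rw [abs_of_nonpos this]
    constructor <;> linarith [hθ.1, hθ.2]
  have h2 := hfar δ Real.pi hδpi fun θ hθ => by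
    have : 0 ≤ θ := by linarith [hθ.1]
    rw [abs_of_nonneg this]
    exact hθ
  have h3 := (h1.add hnear).add h2
  rw [zero_add, add_zero] at h3
  refine h3.congr fun n => ?_
  have hi := h.intervalIntegrable_spec hα₀ hα n
  rw [← intervalIntegral.integral_add_adjacent_intervals (hi (-Real.pi) (-δ)) (hi (-δ) Real.pi),
    ← intervalIntegral.integral_add_adjacent_intervals (hi (-δ) δ) (hi δ Real.pi)]
  ring

lemma tendsto_sum_qCorr (h : RegTail α μ) (hα₀ : 0 < α) (hα : α < 1 / 2) (hμ₀ : μ {0} = 0) :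
    Tendsto (fun n : ℕ => (∑ i ∈ Finset.Icc 1 n, ∑ j ∈ Finset.Icc 1 n,
      qCorr μ ((i : ℤ) - (j : ℤ)).natAbs) * (tail μ n ^ 2 / n)) atTop (𝓝 (K α)) := by
  have hs := h.summable_q_sq hα₀ hα hμ₀
  have h1 := (h.tendsto_integral_spec hα₀ hα).const_mul (2 * Real.pi)⁻¹
  have hpi := Real.pi_pos
  rw [inv_mul_cancel_left₀ (by positivity)] at h1
  refine h1.congr fun n => ?_
  rw [(hasSum_block_sq_qCorr hs n).unique (h.hasSum_block_sq hα₀ hα hμ₀ n), mul_assoc]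
  rfl

end RegTail

end

/-! ### Ancestral lines and components of the graph -/

/-- The parent of a vertex. -/
def parent (k : ℤ → ℕ) (z : ℤ) : ℤ := z - (k z : ℤ)

section graph

variable (k : ℤ → ℕ)

lemma reachable_parent (z : ℤ) : (ancestralGraph k).Reachable z (parent k z) := by
  by_cases h : z = parent k z
  · rw [← h]
  · refine SimpleGraph.Adj.reachable ?_
    rw [ancestralGraph, SimpleGraph.fromRel_adj]
    exact ⟨h, Or.inl rfl⟩

lemma reachable_iterate_parent (z : ℤ) (a : ℕ) :
    (ancestralGraph k).Reachable z ((parent k)^[a] z) := by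
  induction a with
  | zero => exact SimpleGraph.Reachable.refl _
  | succ a ih =>
    rw [Function.iterate_succ_apply']
    exact ih.trans (reachable_parent k _)

/-- Two vertices lie in the same component if and only if their ancestral lines meet. -/
lemma reachable_iff_exists_iterate (u v : ℤ) :
    (ancestralGraph k).Reachable u v ↔ ∃ a b, (parent k)^[a] u = (parent k)^[b] v := by
  constructor
  · rintro ⟨W⟩
    induction W with
    | nil => exact ⟨0, 0, rfl⟩
    | cons hadj _ ih =>
      obtain ⟨a, b, hab⟩ := ih
      rw [ancestralGraph, SimpleGraph.fromRel_adj] at hadj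
      rcases hadj.2 with h | h
      · refine ⟨a + 1, b, ?_⟩
        rw [Function.iterate_succ_apply, ← hab, h]
        rfl
      -- Here the first vertex is the parent of the second: a line of positive length from the
      -- second already passes through the first, and a line of length 0 is compensated by one more
      -- step from `v`.
      · rcases a with _ | a
        · refine ⟨0, b + 1, ?_⟩
          rw [Function.iterate_succ_apply', ← hab, h]
          rfl
        · refine ⟨a, b, ?_⟩
          rw [← hab, Function.iterate_succ_apply, h]
          rfl
  · rintro ⟨a, b, hab⟩
    have h1 := reachable_iterate_parent k u a
    rw [hab] at h1
    exact h1.trans (reachable_iterate_parent k v b).symm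

lemma iterate_parent_le (z : ℤ) (a : ℕ) : (parent k)^[a] z ≤ z := by
  induction a with
  | zero => exact le_rfl
  | succ a ih =>
    rw [Function.iterate_succ_apply']
    refine le_trans ?_ ih
    simp [parent]

/-- Ancestral lines never go up, so a line started below `i` does not read `k i`. This makes the
jump at `i` independent of everything below it. -/
lemma iterate_parent_update {z i : ℤ} (hz : z < i) (x a : ℕ) :
    (parent (Function.update k i x))^[a] z = (parent k)^[a] z := by
  induction a with
  | zero => rfl
  | succ a ih =>
    rw [Function.iterate_succ_apply', Function.iterate_succ_apply', ih]
    have h1 := iterate_parent_le k z a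
    have h2 : (parent k)^[a] z ≠ i := by omega
    simp [parent, h2]

lemma measurable_iterate_parent (z : ℤ) (a : ℕ) :
    Measurable fun k : ℤ → ℕ => (parent k)^[a] z := by
  induction a with
  | zero => exact measurable_const
  | succ a ih =>
    simp_rw [Function.iterate_succ_apply']
    have h1 : Measurable fun b : ℤ × (ℤ → ℕ) => parent b.2 b.1 := by
      refine measurable_from_prod_countable_right fun n => ?_
      have h2 : Measurable fun k : ℤ → ℕ => (k n : ℤ) :=
        measurable_from_nat.comp (measurable_pi_apply n)
      exact measurable_const.sub h2
    exact h1.comp (ih.prodMk measurable_id)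

end graph

/-- The ancestral lines of `i` and `j` meet after at most `T` steps altogether. -/
def meet (T : ℕ) (i j : ℤ) : Set (ℤ → ℕ) :=
  {k | ∃ a b, a + b ≤ T ∧ (parent k)^[a] i = (parent k)^[b] j}

lemma measurableSet_meet (T : ℕ) (i j : ℤ) : MeasurableSet (meet T i j) := by
  have : meet T i j = ⋃ a : ℕ, ⋃ b : ℕ, ⋃ _ : a + b ≤ T,
      {k | (parent k)^[a] i = (parent k)^[b] j} := by
    ext k
    simp [meet]
  rw [this]
  exact MeasurableSet.iUnion fun a => MeasurableSet.iUnion fun b => MeasurableSet.iUnion fun _ =>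
    measurableSet_eq_fun (measurable_iterate_parent i a) (measurable_iterate_parent j b)

lemma meet_mono (i j : ℤ) : Monotone fun T => meet T i j := by
  rintro T T' h k ⟨a, b, hab, he⟩
  exact ⟨a, b, hab.trans h, he⟩

lemma iUnion_meet (i j : ℤ) :
    ⋃ T, meet T i j = {k | (ancestralGraph k).Reachable i j} := by
  ext k
  simp only [Set.mem_iUnion, meet, Set.mem_ofPred_eq, reachable_iff_exists_iterate]
  constructor
  · rintro ⟨T, a, b, _, h⟩
    exact ⟨a, b, h⟩
  · rintro ⟨a, b, h⟩
    exact ⟨a + b, a, b, le_rfl, h⟩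

lemma meet_symm {T : ℕ} {i j : ℤ} : meet T i j = meet T j i := by
  ext k
  constructor <;> rintro ⟨a, b, h1, h2⟩ <;> exact ⟨b, a, by omega, h2.symm⟩

/-! ### Connection probabilities: recursion and maximum principle -/

section law

variable (μ : Measure ℕ) [IsProbabilityMeasure μ]

/-- The probability that `i` and `j` lie in the same component. -/
def connProb (i j : ℤ) : ℝ := (jumpLaw μ).real {k | (ancestralGraph k).Reachable i j}

lemma connProb_comm (i j : ℤ) : connProb μ i j = connProb μ j i := by
  unfold connProb
  simp_rw [SimpleGraph.reachable_comm]

lemma connProb_self (i : ℤ) : connProb μ i i = 1 := by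
  simp [connProb]

lemma hasSum_inter_eval (i : ℤ) {E : Set (ℤ → ℕ)} (hE : MeasurableSet E) :
    HasSum (fun m : ℕ => (jumpLaw μ).real ({k | k i = m} ∩ E)) ((jumpLaw μ).real E) := by
  have hm : ∀ m : ℕ, MeasurableSet ({k : ℤ → ℕ | k i = m} ∩ E) := fun m =>
    (measurableSet_eq_fun (measurable_pi_apply i) measurable_const).inter hE
  have hd : Pairwise (Function.onFun Disjoint fun m : ℕ => {k : ℤ → ℕ | k i = m} ∩ E) := by
    intro a b hab
    refine Set.disjoint_left.2 fun k h1 h2 => hab ?_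
    exact h1.1.symm.trans h2.1
  have hU : ⋃ m : ℕ, ({k : ℤ → ℕ | k i = m} ∩ E) = E := by
    ext k
    simp
  have h1 := measure_iUnion (μ := jumpLaw μ) hd hm
  rw [hU] at h1
  have h2 : ∑' m : ℕ, (jumpLaw μ) ({k | k i = m} ∩ E) ≠ ⊤ := by
    rw [← h1]
    exact measure_ne_top _ _
  have h3 := ENNReal.hasSum_toReal h2
  rw [← ENNReal.tsum_toReal_eq (ENNReal.ne_top_of_tsum_ne_top h2), ← h1] at h3
  exact h3

lemma hasSum_real_singleton : HasSum (fun m : ℕ => μ.real {m}) 1 := by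
  have h1 := hasSum_inter_eval μ 0 MeasurableSet.univ
  rw [probReal_univ] at h1
  refine h1.congr_fun fun m => ?_
  have h2 := infinitePi_inter_eval μ (0 : ℤ) m MeasurableSet.univ (fun _ _ => by simp)
  rw [probReal_univ, mul_one] at h2
  exact h2.symm

lemma eval_inter_zero (hμ₀ : μ {0} = 0) (i : ℤ) (E : Set (ℤ → ℕ)) :
    (jumpLaw μ).real ({k | k i = 0} ∩ E) = 0 := by
  have h1 := infinitePi_inter_eval μ i 0 MeasurableSet.univ (fun _ _ => by simp)
  have h2 : μ.real {0} = 0 := by simp [measureReal_def, hμ₀]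
  rw [h2, zero_mul, Set.inter_univ] at h1
  refine le_antisymm ?_ measureReal_nonneg
  exact (measureReal_mono Set.inter_subset_left).trans h1.le

lemma measureReal_zero_mul (hμ₀ : μ {0} = 0) (x : ℝ) : μ.real {0} * x = 0 := by
  simp [measureReal_def, hμ₀]

/-- First step analysis for the connection probability. -/
lemma hasSum_connProb (hμ₀ : μ {0} = 0) {i j : ℤ} (hij : j < i) :
    HasSum (fun m : ℕ => μ.real {m} * connProb μ (i - m) j) (connProb μ i j) := by
  refine (hasSum_inter_eval μ i (measurableSet_reachable i j)).congr_fun fun m => ?_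
  -- For `m = 0` the vertex `i - m` is not below `i` and independence would fail; that term is null
  -- because `μ {0} = 0`.
  rcases Nat.eq_zero_or_pos m with rfl | hm
  · rw [eval_inter_zero μ hμ₀, measureReal_zero_mul μ hμ₀]
  · have hset : {k : ℤ → ℕ | k i = m} ∩ {k | (ancestralGraph k).Reachable i j} =
        {k : ℤ → ℕ | k i = m} ∩ {k | (ancestralGraph k).Reachable (i - m) j} := by
      ext k
      refine and_congr_right fun hk => ?_
      have h1 := reachable_parent k i
      have hk' : k i = m := hk
      rw [parent, hk'] at h1
      exact ⟨fun h => h1.symm.trans h, fun h => h1.trans h⟩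
    rw [hset, connProb]
    refine (infinitePi_inter_eval μ i m (measurableSet_reachable _ _) fun k x => ?_).symm
    simp only [Set.mem_ofPred_eq, reachable_iff_exists_iterate]
    have h2 : i - (m : ℤ) < i := by omega
    simp_rw [iterate_parent_update k h2, iterate_parent_update k hij]

/-- The line of the lower vertex `j` cannot climb to `i`, so a meeting uses at least one step from
`i`; removing it lowers the total number of steps. -/
lemma meet_succ_le (hμ₀ : μ {0} = 0) {i j : ℤ} (hij : j < i) (T m : ℕ) :
    (jumpLaw μ).real ({k | k i = m} ∩ meet (T + 1) i j) ≤
      μ.real {m} * (jumpLaw μ).real (meet T (i - m) j) := by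
  rcases Nat.eq_zero_or_pos m with rfl | hm
  · rw [eval_inter_zero μ hμ₀, measureReal_zero_mul μ hμ₀]
  · have h2 : i - (m : ℤ) < i := by omega
    have h3 := infinitePi_inter_eval μ i m (measurableSet_meet T (i - m) j) fun k x => by
      simp only [meet, Set.mem_ofPred_eq]
      simp_rw [iterate_parent_update k h2, iterate_parent_update k hij]
    refine le_trans (measureReal_mono ?_) h3.le
    rintro k ⟨hk, a, b, hab, he⟩
    have hk' : k i = m := hk
    refine ⟨hk, ?_⟩
    rcases a with _ | a
    · have h4 := iterate_parent_le k j b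
      rw [← he] at h4
      simp only [Function.iterate_zero, id] at h4
      omega
    · refine ⟨a, b, by omega, ?_⟩
      rw [Function.iterate_succ_apply, parent, hk'] at he
      exact he

variable {μ}

lemma qCorr_nonneg (i : ℕ) : 0 ≤ qCorr μ i :=
  tsum_nonneg fun _ => mul_nonneg (q_nonneg μ _) (q_nonneg μ _)

/-- Weighted form of `2xy ≤ c x² + y² / c`. With `c = 1` it gives the maximum at lag 0; with `c`
small it gives decay at infinity, since the shifted sum tends to 0. -/
lemma qCorr_le_weighted (hs : Summable fun t : ℕ => q μ t ^ 2) (i : ℕ) {c : ℝ} (hc : 0 < c) :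
    qCorr μ i ≤ c / 2 * ∑' t, q μ t ^ 2 + (2 * c)⁻¹ * ∑' t, q μ (t + i) ^ 2 := by
  have h1 : Summable fun t : ℕ => q μ (t + i) ^ 2 := hs.comp_injective (add_left_injective i)
  rw [← tsum_mul_left, ← tsum_mul_left, ← (hs.mul_left _).tsum_add (h1.mul_left _)]
  refine (summable_qCorr hs i).tsum_le_tsum (fun t => ?_) ((hs.mul_left _).add (h1.mul_left _))
  rw [add_comm i t]
  have h2 : c / 2 * q μ t ^ 2 + (2 * c)⁻¹ * q μ (t + i) ^ 2 - q μ t * q μ (t + i) =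
      (2 * c)⁻¹ * (c * q μ t - q μ (t + i)) ^ 2 := by
    field_simp
    ring
  have h3 : 0 ≤ (2 * c)⁻¹ * (c * q μ t - q μ (t + i)) ^ 2 := by positivity
  linarith

lemma qCorr_zero_eq : qCorr μ 0 = ∑' t, q μ t ^ 2 := by
  simp [qCorr, sq]

lemma qCorr_le_zero_lag (hs : Summable fun t : ℕ => q μ t ^ 2) (i : ℕ) :
    qCorr μ i ≤ qCorr μ 0 := by
  have h1 := qCorr_le_weighted hs i one_pos
  have h3 : Summable fun t : ℕ => q μ (t + i) ^ 2 := hs.comp_injective (add_left_injective i)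
  have h2 : ∑' t, q μ (t + i) ^ 2 ≤ ∑' t, q μ t ^ 2 :=
    h3.tsum_le_tsum_of_inj _ (add_left_injective i) (fun _ _ => sq_nonneg _) (fun _ => le_rfl) hs
  rw [qCorr_zero_eq]
  linarith

lemma tendsto_qCorr (hs : Summable fun t : ℕ => q μ t ^ 2) :
    Tendsto (qCorr μ) atTop (𝓝 0) := by
  have h0 : 0 < qCorr μ 0 := zero_lt_one.trans_le (one_le_qCorr_zero hs)
  rw [Metric.tendsto_atTop]
  intro ε hε
  -- This makes the first weighted term `ε / 2`; a shifted sum below `c ε` then makes the second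
  -- smaller than `ε / 2`.
  set c := ε / qCorr μ 0 with hc
  have hc0 : 0 < c := by positivity
  have ht := tendsto_sum_nat_add fun t => q μ t ^ 2
  obtain ⟨N, hN⟩ := (Metric.tendsto_atTop.1 ht) (c * ε) (by positivity)
  refine ⟨N, fun i hi => ?_⟩
  have h1 := qCorr_le_weighted hs i hc0
  have h2 := hN i hi
  rw [Real.dist_eq, sub_zero] at h2 ⊢
  have h3 := (le_abs_self _).trans_lt h2
  rw [abs_of_nonneg (qCorr_nonneg i)]
  rw [← qCorr_zero_eq] at h1
  have h4 : c / 2 * qCorr μ 0 = ε / 2 := by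
    rw [hc]
    field_simp
  have h5 : (2 * c)⁻¹ * ∑' t, q μ (t + i) ^ 2 < (2 * c)⁻¹ * (c * ε) := by gcongr
  have h6 : (2 * c)⁻¹ * (c * ε) = ε / 2 := by field_simp
  linarith

/-- The correlations of the renewal sequence satisfy the same recursion. -/
lemma hasSum_qCorr (hs : Summable fun t : ℕ => q μ t ^ 2) {d : ℕ} (hd : 1 ≤ d) :
    HasSum (fun m : ℕ => μ.real {m} * qCorr μ ((d : ℤ) - m).natAbs) (qCorr μ d) := by
  -- Summing over `s` first gives the left side of the recursion; summing over `m` first turns `∑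
  -- μ{m} q_{s-m}` into `q_s` by the renewal equation.
  let f : ℕ × ℕ → ℝ := fun p => μ.real {p.1} * (delayed μ d p.2 * delayed μ p.1 p.2)
  have hf0 : ∀ p, 0 ≤ f p := fun p =>
    mul_nonneg measureReal_nonneg (mul_nonneg (delayed_nonneg μ _ _) (delayed_nonneg μ _ _))
  have hrow : ∀ m : ℕ, HasSum (fun s => f (m, s)) (μ.real {m} * qCorr μ ((d : ℤ) - m).natAbs) :=
    fun m => (hasSum_delayed_mul hs d m).mul_left _
  have hsum : Summable fun m : ℕ => μ.real {m} * qCorr μ ((d : ℤ) - m).natAbs := by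
    refine ((hasSum_real_singleton μ).summable.mul_right (qCorr μ 0)).of_nonneg_of_le
      (fun m => mul_nonneg measureReal_nonneg (qCorr_nonneg _)) fun m => ?_
    exact mul_le_mul_of_nonneg_left (qCorr_le_zero_lag hs _) measureReal_nonneg
  have hfs : Summable f := by
    rw [summable_prod_of_nonneg hf0]
    refine ⟨fun m => (hrow m).summable, hsum.congr fun m => (hrow m).tsum_eq.symm⟩
  have hcol : ∀ s : ℕ, HasSum (fun m => f (m, s)) (delayed μ d s * delayed μ 0 s) := by
    intro s
    -- The renewal equation fails at `s = 0`, but there the factor delayed by `d ≥ 1` vanishes.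
    rcases Nat.eq_zero_or_pos s with rfl | hs1
    · have h0 : delayed μ d 0 = 0 := by
        have : ¬ d ≤ 0 := by omega
        simp [delayed, this]
      simp only [f, h0, zero_mul, mul_zero]
      exact hasSum_zero
    · have h1 : HasSum (fun m => μ.real {m} * delayed μ m s) (delayed μ 0 s) := by
        have h2 : delayed μ 0 s = ∑ m ∈ Finset.range (s + 1), μ.real {m} * delayed μ m s := by
          have h3 : delayed μ 0 s = q μ s := by simp [delayed]
          rw [h3, q_renewal μ hs1]
          refine Finset.sum_congr rfl fun m hm => ?_
          have : m ≤ s := Nat.lt_succ_iff.1 (Finset.mem_range.1 hm)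
          simp [delayed, this]
        rw [h2]
        refine hasSum_sum_of_ne_finset_zero fun m hm => ?_
        have : ¬ m ≤ s := fun h => hm (Finset.mem_range.2 (Nat.lt_succ_of_le h))
        simp [delayed, this]
      refine (h1.mul_left (delayed μ d s)).congr_fun fun m => ?_
      simp only [f]
      ring
  have hd0 := hasSum_delayed_mul hs d 0
  have hnat : ((d : ℤ) - (0 : ℕ)).natAbs = d := by simp
  rw [hnat] at hd0
  have hcomm : ∑' m, ∑' s, f (m, s) = ∑' s, ∑' m, f (m, s) :=
    Summable.tsum_comm (f := fun s m => f (m, s)) hfs.prod_symm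
  rw [tsum_congr fun m => (hrow m).tsum_eq, tsum_congr fun s => (hcol s).tsum_eq, hd0.tsum_eq] at hcomm
  rw [← hcomm]
  exact hsum.hasSum

/-- The upper bound `c_{|i-j|} / c_0` for the connection probability. -/
lemma meet_le (hμ₀ : μ {0} = 0) (hs : Summable fun t : ℕ => q μ t ^ 2) (T : ℕ) :
    ∀ i j : ℤ, (jumpLaw μ).real (meet T i j) ≤ qCorr μ (i - j).natAbs / qCorr μ 0 := by
  have h0 : 0 < qCorr μ 0 := zero_lt_one.trans_le (one_le_qCorr_zero hs)
  induction T with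
  | zero =>
    intro i j
    by_cases hij : i = j
    · subst hij
      simp only [sub_self, Int.natAbs_zero]
      rw [div_self h0.ne']
      exact measureReal_le_one
    · have : meet 0 i j = ∅ := by
        ext k
        simp only [meet, Set.mem_ofPred_eq, Set.mem_empty_iff_false, iff_false]
        rintro ⟨a, b, hab, he⟩
        obtain ⟨rfl, rfl⟩ : a = 0 ∧ b = 0 := by omega
        exact hij he
      rw [this, measureReal_empty]
      exact div_nonneg (qCorr_nonneg _) h0.le
  | succ T ih =>
    -- The first step is taken from the larger vertex; the other order follows by symmetry. The
    -- bound is preserved because the normalised correlation satisfies the recursion exactly.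
    have key : ∀ i j : ℤ, j < i →
        (jumpLaw μ).real (meet (T + 1) i j) ≤ qCorr μ (i - j).natAbs / qCorr μ 0 := by
      intro i j hij
      have h1 := hasSum_inter_eval μ i (measurableSet_meet (T + 1) i j)
      have h2 := (hasSum_qCorr hs (d := (i - j).natAbs) (by omega)).div_const (qCorr μ 0)
      refine hasSum_le (fun m => ?_) h1 h2
      refine (meet_succ_le μ hμ₀ hij T m).trans ?_
      rw [mul_div_assoc]
      have h3 := ih (i - m) j
      have h4 : (i - m - j).natAbs = (((i - j).natAbs : ℤ) - m).natAbs := by omega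
      rw [h4] at h3
      exact mul_le_mul_of_nonneg_left h3 measureReal_nonneg
    intro i j
    rcases lt_trichotomy i j with h | h | h
    · have h5 := key j i h
      have h6 : (j - i).natAbs = (i - j).natAbs := by omega
      rwa [meet_symm, h6] at h5
    · subst h
      simp only [sub_self, Int.natAbs_zero]
      rw [div_self h0.ne']
      exact measureReal_le_one
    · exact key i j h

lemma connProb_le (hμ₀ : μ {0} = 0) (hs : Summable fun t : ℕ => q μ t ^ 2) (i j : ℤ) :
    connProb μ i j ≤ qCorr μ (i - j).natAbs / qCorr μ 0 := by
  have h1 := tendsto_measure_iUnion_atTop (μ := jumpLaw μ) (meet_mono i j)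
  rw [iUnion_meet] at h1
  have h2 := (ENNReal.tendsto_toReal (measure_ne_top _ _)).comp h1
  exact le_of_tendsto' h2 fun T => meet_le hμ₀ hs T i j

/-- The connection probability is the normalised correlation of the renewal sequence. -/
lemma connProb_eq (hμ₀ : μ {0} = 0) (hs : Summable fun t : ℕ => q μ t ^ 2)
    (htail : ∀ y, 0 < tail μ y) (i j : ℤ) :
    connProb μ i j = qCorr μ (i - j).natAbs / qCorr μ 0 := by
  have h0 : 0 < qCorr μ 0 := zero_lt_one.trans_le (one_le_qCorr_zero hs)
  -- The defect is nonnegative, zero on the diagonal, decaying away from it, and averaged by the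
  -- jump of the larger vertex; a positive supremum will be contradicted.
  let g : ℤ × ℤ → ℝ := fun p => qCorr μ (p.1 - p.2).natAbs / qCorr μ 0 - connProb μ p.1 p.2
  have hg0 : ∀ p, 0 ≤ g p := fun p => sub_nonneg.2 (connProb_le hμ₀ hs _ _)
  have hgc : ∀ p, g p ≤ qCorr μ (p.1 - p.2).natAbs / qCorr μ 0 := fun p =>
    sub_le_self _ measureReal_nonneg
  have hbdd : BddAbove (Set.range g) := by
    refine ⟨1, ?_⟩
    rintro _ ⟨p, rfl⟩
    refine (hgc p).trans ?_
    rw [div_le_one h0]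
    exact qCorr_le_zero_lag hs _
  have hgself : ∀ i, g (i, i) = 0 := by
    intro i
    simp [g, connProb_self, h0.ne']
  have hgsymm : ∀ i j, g (i, j) = g (j, i) := by
    intro i j
    simp only [g]
    rw [connProb_comm, ← Int.natAbs_neg, neg_sub]
  have hharm : ∀ i j, j < i → HasSum (fun m : ℕ => μ.real {m} * g (i - m, j)) (g (i, j)) := by
    intro i j hij
    have h1 := (hasSum_qCorr hs (d := (i - j).natAbs) (by omega)).div_const (qCorr μ 0)
    refine (h1.sub (hasSum_connProb μ hμ₀ hij)).congr_fun fun m => ?_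
    have h4 : (i - m - j).natAbs = (((i - j).natAbs : ℤ) - m).natAbs := by omega
    simp only [g]
    rw [h4]
    ring
  suffices hz : ∀ p, g p = 0 from (sub_eq_zero.1 (hz (i, j))).symm
  by_contra! hne
  obtain ⟨p₀, hp₀⟩ := hne
  set s := ⨆ p, g p with hsdef
  have hs0 : 0 < s := (lt_of_le_of_ne (hg0 p₀) hp₀.symm).trans_le (le_ciSup hbdd p₀)
  have hdecay : ∃ D : ℕ, ∀ p : ℤ × ℤ, D ≤ (p.1 - p.2).natAbs → g p < s / 2 := by
    have h1 := (tendsto_qCorr hs).div_const (qCorr μ 0)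
    rw [zero_div] at h1
    obtain ⟨D, hD⟩ := eventually_atTop.1 (h1.eventually (gt_mem_nhds (half_pos hs0)))
    exact ⟨D, fun p hp => (hgc p).trans_lt (hD _ hp)⟩
  obtain ⟨D, hD⟩ := hdecay
  -- The tail never vanishes, so long jumps have positive mass. A jump of at least `2 D` takes a
  -- pair at distance below `D` to distance at least `D`, where `g < s / 2`.
  have hsupp : ∃ m : ℕ, 2 * D ≤ m ∧ 0 < μ.real {m} := by
    by_contra! hcon
    have h1 : ∀ m ∈ Set.Ici (2 * D), μ {m} = 0 := fun m hm =>
      (measureReal_eq_zero_iff).1 (le_antisymm (hcon m hm) measureReal_nonneg)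
    have h2 : μ (Set.Ici (2 * D)) = 0 := by
      rw [← Set.biUnion_of_singleton (Set.Ici (2 * D))]
      exact (measure_biUnion_null_iff (Set.to_countable _)).2 h1
    have h3 := htail (2 * D : ℕ)
    rw [tail_natCast, measureReal_def, h2] at h3
    simp at h3
  obtain ⟨m, hm, hm0⟩ := hsupp
  -- Closeness `s / 2` to the supremum excludes distant pairs and the diagonal; closeness `μ{m} s /
  -- 4` contradicts the loss of more than `μ{m} s / 2` caused by the jump `m`.
  have hmin : 0 < min (μ.real {m} * s / 4) (s / 2) := by positivity
  obtain ⟨⟨i, j⟩, hij⟩ := exists_lt_of_lt_ciSup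
    (show s - min (μ.real {m} * s / 4) (s / 2) < ⨆ p, g p by rw [← hsdef]; linarith)
  have main : ∀ i j : ℤ, j < i → s - min (μ.real {m} * s / 4) (s / 2) < g (i, j) → False := by
    intro i j hlt hgt
    have hclose : (i - j).natAbs < D := by
      by_contra! hfar
      have := hD (i, j) hfar
      linarith [min_le_right (μ.real {m} * s / 4) (s / 2)]
    have h1 := ((hasSum_real_singleton μ).mul_right s).sub (hharm i j hlt)
    have h2 := le_hasSum h1 m fun l _ => by
      have := le_ciSup hbdd (i - l, j)
      have h3 : 0 ≤ μ.real {l} := measureReal_nonneg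
      rw [← hsdef] at this
      nlinarith
    have h3 := hD (i - m, j) (by simp only; omega)
    have h4 := min_le_left (μ.real {m} * s / 4) (s / 2)
    nlinarith
  rcases lt_trichotomy i j with h | h | h
  · rw [hgsymm] at hij
    exact main j i h hij
  · subst h
    rw [hgself] at hij
    linarith [min_le_right (μ.real {m} * s / 4) (s / 2)]
  · exact main i j h hij

end law

/-! ### Covariances of the labels and the variance of the walk -/

section variance

variable (μ : Measure ℕ) [IsProbabilityMeasure μ] (p : unitInterval)

lemma integral_gibbs {f : (ℤ → ℤ) → ℝ} (hf : Integrable f (gibbs μ p)) :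
    ∫ X, f X ∂(gibbs μ p) = ∫ k, ∫ X, f X ∂(labelLaw p k) ∂(jumpLaw μ) := by
  let κ : Kernel (ℤ → ℕ) (ℤ → ℤ) := ⟨labelLaw p, measurable_labelLaw p⟩
  have h : gibbs μ p = (κ ∘ₖ Kernel.const Unit (jumpLaw μ)) () := by
    rw [Kernel.comp_apply, Kernel.const_apply]
    rfl
  rw [h] at hf ⊢
  rw [Kernel.integral_comp hf, Kernel.const_apply]
  rfl

lemma integral_labelLaw {f : (ℤ → ℤ) → ℝ} (hf : Measurable f) (k : ℤ → ℕ) :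
    ∫ X, f X ∂(labelLaw p k) =
      ∫ ξ, f (fun z => ξ ((ancestralGraph k).connectedComponentMk z))
        ∂(Measure.infinitePi fun _ : (ancestralGraph k).ConnectedComponent =>
          bernoulliMeasure (1 : ℤ) (-1) p) := by
  rw [labelLaw, integral_map]
  · exact (measurable_pi_lambda _ fun z => measurable_pi_apply _).aemeasurable
  · exact hf.aestronglyMeasurable

lemma measurable_coord (z : ℤ) : Measurable fun X : ℤ → ℤ => (X z : ℝ) :=
  (measurable_of_countable _ : Measurable fun m : ℤ => (m : ℝ)).comp (measurable_pi_apply z)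

/-- The integral of a function of one label. -/
lemma integral_labelLaw_coord (g : ℤ → ℝ) (k : ℤ → ℕ) (z : ℤ) :
    ∫ X, g (X z) ∂(labelLaw p k) = p * g 1 + (1 - p) * g (-1) := by
  have hg : Measurable g := measurable_of_countable g
  rw [integral_labelLaw p (f := fun X => g (X z)) (hg.comp (measurable_pi_apply z))]
  have h1 := Measure.infinitePi_map_eval (fun _ : (ancestralGraph k).ConnectedComponent =>
    bernoulliMeasure (1 : ℤ) (-1) p) ((ancestralGraph k).connectedComponentMk z)
  have h2 := integral_map (μ := Measure.infinitePi fun _ : (ancestralGraph k).ConnectedComponent =>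
    bernoulliMeasure (1 : ℤ) (-1) p) (φ := Function.eval ((ancestralGraph k).connectedComponentMk z))
    (measurable_pi_apply _).aemeasurable (f := g) hg.aestronglyMeasurable
  rw [h1, integral_bernoulliMeasure] at h2
  simp only [smul_eq_mul] at h2
  rw [h2]

open Classical in
/-- Labels of two vertices: equal on the same component, independent otherwise. -/
lemma integral_labelLaw_mul (k : ℤ → ℕ) (i j : ℤ) :
    ∫ X, (X i : ℝ) * X j ∂(labelLaw p k) =
      if (ancestralGraph k).Reachable i j then 1 else (2 * p - 1 : ℝ) ^ 2 := by
  rw [integral_labelLaw p (f := fun X => (X i : ℝ) * X j) ((measurable_coord i).mul (measurable_coord j))]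
  split_ifs with h
  · have h1 := SimpleGraph.ConnectedComponent.sound h
    simp only [h1]
    have h2 := integral_labelLaw_coord p (fun m => (m : ℝ) * m) k j
    rw [integral_labelLaw p (f := fun X => (X j : ℝ) * X j) ((measurable_coord j).mul (measurable_coord j))] at h2
    rw [h2]
    push_cast
    ring
  · have h1 : (ancestralGraph k).connectedComponentMk i ≠ (ancestralGraph k).connectedComponentMk j :=
      fun he => h (SimpleGraph.ConnectedComponent.exact he)
    have h2 := Measure.infinitePi_map_eval_prod (P := fun _ : (ancestralGraph k).ConnectedComponent =>
      bernoulliMeasure (1 : ℤ) (-1) p) h1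
    have h3 := integral_map (μ := Measure.infinitePi fun _ : (ancestralGraph k).ConnectedComponent =>
      bernoulliMeasure (1 : ℤ) (-1) p)
      (φ := fun ω => (ω ((ancestralGraph k).connectedComponentMk i),
        ω ((ancestralGraph k).connectedComponentMk j)))
      (by fun_prop) (f := fun a : ℤ × ℤ => (a.1 : ℝ) * a.2)
      (measurable_of_countable _).aestronglyMeasurable
    rw [h2, integral_prod_mul (fun m : ℤ => (m : ℝ)) (fun m : ℤ => (m : ℝ)),
      integral_bernoulliMeasure] at h3
    simp only at h3
    rw [← h3]
    simp only [smul_eq_mul]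
    push_cast
    ring

/-- The labels are arbitrary integers as far as the type goes; that only ±1 is charged supplies the
square integrability needed for covariances. -/
lemma ae_abs_le_one (z : ℤ) : ∀ᵐ X ∂(gibbs μ p), ‖(X z : ℝ)‖ ≤ 1 := by
  have hS : MeasurableSet {X : ℤ → ℤ | ¬ ‖(X z : ℝ)‖ ≤ 1} :=
    (measurableSet_le (measurable_coord z).norm measurable_const).compl
  rw [ae_iff, gibbs, Measure.bind_apply hS (measurable_labelLaw p).aemeasurable]
  refine (lintegral_eq_zero_iff' ?_).2 (ae_of_all _ fun k => ?_)
  · exact ((Measure.measurable_coe hS).comp (measurable_labelLaw p)).aemeasurable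
  · have hT : MeasurableSet {m : ℤ | ¬ ‖(m : ℝ)‖ ≤ 1} := MeasurableSet.of_discrete
    have h1 := integral_labelLaw_coord p ({m : ℤ | ¬ ‖(m : ℝ)‖ ≤ 1}.indicator 1) k z
    have h2 : (fun X : ℤ → ℤ => {m : ℤ | ¬ ‖(m : ℝ)‖ ≤ 1}.indicator (1 : ℤ → ℝ) (X z)) =
        {X : ℤ → ℤ | ¬ ‖(X z : ℝ)‖ ≤ 1}.indicator 1 := by
      funext X
      simp [Set.indicator_apply]
    rw [h2, integral_indicator_one hS] at h1
    have h3 : (labelLaw p k).real {X : ℤ → ℤ | ¬ ‖(X z : ℝ)‖ ≤ 1} = 0 := by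
      rw [h1]
      simp
    exact (measureReal_eq_zero_iff).1 h3

lemma memLp_coord (z : ℤ) : MemLp (fun X : ℤ → ℤ => (X z : ℝ)) 2 (gibbs μ p) :=
  MemLp.of_bound (measurable_coord z).aestronglyMeasurable 1 (ae_abs_le_one μ p z)

lemma integral_coord (z : ℤ) : ∫ X, (X z : ℝ) ∂(gibbs μ p) = 2 * p - 1 := by
  rw [integral_gibbs μ p ((memLp_coord μ p z).integrable one_le_two)]
  simp_rw [integral_labelLaw_coord p (fun m => (m : ℝ))]
  simp
  ring

/-- The covariance of two labels. -/
lemma covariance_coord (i j : ℤ) :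
    cov[fun X : ℤ → ℤ => (X i : ℝ), fun X => (X j : ℝ); gibbs μ p] =
      4 * p * (1 - p) * connProb μ i j := by
  classical
  rw [covariance_eq_sub (memLp_coord μ p i) (memLp_coord μ p j), integral_coord, integral_coord]
  have hint := (memLp_coord μ p i).integrable_mul (memLp_coord μ p j)
  have h1 := integral_gibbs μ p hint
  simp only [Pi.mul_apply] at h1 ⊢
  rw [h1]
  simp_rw [integral_labelLaw_mul]
  -- Conditionally on the graph the product has mean 1 on connection and `(2p - 1)²` otherwise, so
  -- the covariance is `1 - (2p - 1)² = 4p(1 - p)` times the connection probability.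
  have hR := measurableSet_reachable i j
  have h2 : (fun k : ℤ → ℕ => if (ancestralGraph k).Reachable i j then (1 : ℝ) else
      (2 * p - 1 : ℝ) ^ 2) = fun k => (2 * p - 1 : ℝ) ^ 2 +
        {k : ℤ → ℕ | (ancestralGraph k).Reachable i j}.indicator
          (fun _ => 1 - (2 * p - 1 : ℝ) ^ 2) k := by
    funext k
    by_cases h : (ancestralGraph k).Reachable i j <;> simp [h]
  rw [h2, integral_add (integrable_const _) ((integrable_const _).indicator hR),
    integral_indicator_const _ hR]
  simp only [integral_const, probReal_univ, smul_eq_mul, connProb]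
  ring

lemma sum_Icc_int_eq (f : ℤ → ℝ) (n : ℕ) :
    ∑ i ∈ Finset.Icc (1 : ℤ) n, f i = ∑ i ∈ Finset.Icc 1 n, f i := by
  symm
  refine Finset.sum_nbij (fun i : ℕ => (i : ℤ)) (fun i hi => ?_) (fun a _ b _ h => Int.ofNat.inj h)
    (fun z hz => ?_) (fun _ _ => rfl)
  · simp only [Finset.mem_Icc] at hi ⊢
    omega
  · simp only [Finset.coe_Icc, Set.mem_Icc, Set.mem_image] at hz ⊢
    exact ⟨z.toNat, by omega, by omega⟩

lemma variance_walk (n : ℕ) :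
    Var[fun X : ℤ → ℤ => (walk n X : ℝ); gibbs μ p] =
      ∑ i ∈ Finset.Icc 1 n, ∑ j ∈ Finset.Icc 1 n, 4 * p * (1 - p) * connProb μ i j := by
  have h1 : (fun X : ℤ → ℤ => (walk n X : ℝ)) =
      ∑ i ∈ Finset.Icc (1 : ℤ) n, fun X : ℤ → ℤ => (X i : ℝ) := by
    funext X
    simp [walk]
  have h2 : AEMeasurable (∑ i ∈ Finset.Icc (1 : ℤ) n, fun X : ℤ → ℤ => (X i : ℝ)) (gibbs μ p) :=
    (memLp_finsetSum' _ fun i _ => memLp_coord μ p i).aestronglyMeasurable.aemeasurable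
  rw [h1, ← covariance_self h2, covariance_sum_sum' (fun i _ => memLp_coord μ p i)
    (fun j _ => memLp_coord μ p j), sum_Icc_int_eq]
  refine Finset.sum_congr rfl fun i _ => ?_
  rw [sum_Icc_int_eq]
  exact Finset.sum_congr rfl fun j _ => covariance_coord μ p i j

end variance

end FracWalk

end

theorem lemma3p1 (α : ℝ) (hα₀ : 0 < α) (hα : α < 1 / 2)
    (μ : Measure ℕ) [IsProbabilityMeasure μ] (hμ₀ : μ {0} = 0)
    (L : ℝ → ℝ) (hL : FracWalk.MemGamma α μ L)
    (p : unitInterval) (hp₀ : 0 < (p : ℝ)) (hp₁ : (p : ℝ) < 1) :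
    (∀ i : ℕ, Summable fun j : ℕ => FracWalk.q μ j * FracWalk.q μ (i + j)) ∧
    (∀ n : ℕ,
      Var[fun X : ℤ → ℤ => (FracWalk.walk n X : ℝ); FracWalk.gibbs μ p] =
        4 * p * (1 - p) / FracWalk.qCorr μ 0 *
          ∑ i ∈ Finset.Icc 1 n, ∑ j ∈ Finset.Icc 1 n,
            FracWalk.qCorr μ ((i : ℤ) - (j : ℤ)).natAbs) ∧
    Asymptotics.IsEquivalent atTop
      (fun n : ℕ => Var[fun X : ℤ → ℤ => (FracWalk.walk n X : ℝ); FracWalk.gibbs μ p])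
      (fun n : ℕ => 4 * p * (1 - p) * FracWalk.K α / FracWalk.qCorr μ 0 *
        (n : ℝ) ^ (2 * α + 1) * (L n) ^ (-2 : ℤ)) := by
  have h := hL.regTail
  have hs := h.summable_q_sq hα₀ hα hμ₀
  have hc0 : 0 < FracWalk.qCorr μ 0 := zero_lt_one.trans_le (FracWalk.one_le_qCorr_zero hs)
  have hvar : ∀ n : ℕ,
      Var[fun X : ℤ → ℤ => (FracWalk.walk n X : ℝ); FracWalk.gibbs μ p] =
        4 * p * (1 - p) / FracWalk.qCorr μ 0 *
          ∑ i ∈ Finset.Icc 1 n, ∑ j ∈ Finset.Icc 1 n,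
            FracWalk.qCorr μ ((i : ℤ) - (j : ℤ)).natAbs := by
    intro n
    rw [FracWalk.variance_walk, Finset.mul_sum]
    refine Finset.sum_congr rfl fun i _ => ?_
    rw [Finset.mul_sum]
    refine Finset.sum_congr rfl fun j _ => ?_
    rw [FracWalk.connProb_eq hμ₀ hs h.pos]
    ring
  refine ⟨FracWalk.summable_qCorr hs, hvar, ?_⟩
  have hp : 0 < 1 - (p : ℝ) := sub_pos.2 hp₁
  have hK : 0 < FracWalk.K α := by
    have hG1 : 0 < Real.Gamma (1 - α) := Real.Gamma_pos_of_pos (by linarith)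
    have hG2 : 0 < Real.Gamma (2 * α) := Real.Gamma_pos_of_pos (by linarith)
    have hcos : 0 < Real.cos (Real.pi * α) := by
      have hpi := Real.pi_pos
      apply Real.cos_pos_of_mem_Ioo
      constructor <;> nlinarith
    unfold FracWalk.K
    positivity
  -- Since `tail n = n ^ (-α) L n`, the claimed order is `n / tail²`, the normalisation of the
  -- spectral limit.
  have hscale : ∀ n : ℕ, 1 ≤ n →
      (n : ℝ) ^ (2 * α + 1) * (L n) ^ (-2 : ℤ) = (FracWalk.tail μ n ^ 2 / n)⁻¹ ∧
        0 < FracWalk.tail μ n ^ 2 / n := by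
    intro n hn
    have hn0 : (0 : ℝ) < n := by exact_mod_cast hn
    have hLn := hL.1.1 n hn0
    have hT := h.pos n
    refine ⟨?_, by positivity⟩
    rw [hL.tail_eq hn, Real.rpow_add hn0, Real.rpow_one, mul_comm 2 α, Real.rpow_mul hn0.le,
      Real.rpow_two, Real.rpow_neg hn0.le, zpow_neg]
    have := Real.rpow_pos_of_pos hn0 α
    norm_cast
    field_simp
  have hlim := h.tendsto_sum_qCorr hα₀ hα hμ₀
  rw [Asymptotics.isEquivalent_iff_tendsto_one]
  · have h1 := hlim.div_const (FracWalk.K α)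
    rw [div_self hK.ne'] at h1
    refine h1.congr' ?_
    filter_upwards [eventually_ge_atTop 1] with n hn
    obtain ⟨h2, h3⟩ := hscale n hn
    rw [Pi.div_apply, hvar, mul_assoc (4 * (p : ℝ) * (1 - p) * FracWalk.K α / _), h2]
    generalize FracWalk.tail μ n ^ 2 / (n : ℝ) = x at h3 ⊢
    field_simp
  · filter_upwards [eventually_ge_atTop 1] with n hn
    obtain ⟨h2, h3⟩ := hscale n hn
    rw [mul_assoc, h2]
    positivity
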